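/- A tournament on $[n]$ is a loopless digraph with exactly one directed edge between any two distinct vertices. It is presented as a stream that lists each of its edges exactly once, in an arbitrary (adversarial) order; a $p$-pass algorithm reads this stream $p$ times in the same order. Space is measured in bits: an algorithm that uses $s$ bits of space has at most $2^s$ memory contents, and its output is determined by the final memory contents (and, for a randomized algorithm, its coin tosses). A randomized algorithm solves a problem if, for every tournament and every order of its edges, its output is wrong with probability at most $1/3$. For a digraph $G$ on $n$ vertices let $\beta_G$ be the minimum, over all orderings $\sigma$ of the vertices, of the number of edges $(v,u)$ of $G$ with $\sigma(u)<\sigma(v)$ (the size of a minimum feedback arc set). 1. Deciding whether a tournament on $n$ vertices is acyclic is possible, deterministically, in one pass and $O(n\log n)$ space ($n\ge 2$). This holds in the above (non-uniform) model, and also for a single random access machine program that works for all $n$, where all of the working memory is counted (number of memory cells times number of bits per cell). 2. There are constants $c>0$ and $n_0$ such that, for all $n\ge n_0$ and $p\ge1$, every randomized (in particular, every deterministic) $p$-pass algorithm that decides whether a tournament on $n$ vertices is acyclic uses at least $c\,n/p$ bits of space. 3. There are constants $c>0$ and $n_0$ such that, for all $n\ge n_0$, $p\ge1$ and all real $\alpha\ge1$,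 every randomized (in particular, every deterministic) $p$-pass algorithm that, given a tournament $G$ on $n$ vertices, outputs an integer $\hat\beta\in[\beta_G,\alpha\beta_G]$ uses at least $c\,n/p$ bits of space. -/

import Mathlib

universe u

namespace TournamentStream

/-! ### Digraphs and the quantities attached to them -/

/-- A tournament: no loops, and exactly one directed edge between any two distinct vertices. -/
def IsTournament {V : Type*} (G : Digraph V) : Prop :=
  (∀ v, ¬ G.Adj v v) ∧ ∀ v w, v ≠ w → Xor (G.Adj v w) (G.Adj w v)

/-- A digraph is acyclic if no vertex can be reached from itself by a directed walk of
positive length. -/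
def IsAcyclic {V : Type*} (G : Digraph V) : Prop :=
  ∀ v, ¬ Relation.TransGen G.Adj v v

/-- The back edges of `G` with respect to the ordering that puts the vertex `v` at
position `σ v`. -/
def backEdges {n : ℕ} (G : Digraph (Fin n)) (σ : Equiv.Perm (Fin n)) : Set (Fin n × Fin n) :=
  {e | G.Adj e.1 e.2 ∧ σ e.2 < σ e.1}

/-- The size of a minimum feedback arc set: the least number of back edges of an ordering. -/
noncomputable def fasSize {n : ℕ} (G : Digraph (Fin n)) : ℕ :=
  ⨅ σ : Equiv.Perm (Fin n), (backEdges G σ).ncard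

/-- The list `l` presents `G` as a stream: it lists every edge of `G` exactly once, in an
arbitrary order. -/
def IsStreamOf {n : ℕ} (G : Digraph (Fin n)) (l : List (Fin n × Fin n)) : Prop :=
  l.Nodup ∧ ∀ e, e ∈ l ↔ G.Adj e.1 e.2

/-! ### The problems: `Q G b` says that `b` is a correct output on the input `G` -/

/-- Deciding acyclicity. -/
def acyc {n : ℕ} (G : Digraph (Fin n)) (b : Bool) : Prop :=
  b = true ↔ IsAcyclic G

/-- `α`-approximation of the size of a minimum feedback arc set. -/
def fasSizeApprox (α : ℝ) {n : ℕ} (G : Digraph (Fin n)) (b : ℤ) : Prop :=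
  (fasSize G : ℝ) ≤ b ∧ (b : ℝ) ≤ α * fasSize G

/-! ### Multi-pass streaming algorithms with `s` bits of memory -/

/-- A deterministic streaming algorithm with tokens in `τ`, outputs in `β` and `s` bits of memory,
i.e. with memory contents in a set of size `2 ^ s`.
The memory is updated at each token; the update may depend on the number of the current
pass and on the position of the token in the stream (so that, once the coin tosses of a randomized
algorithm are fixed, fresh tosses made at each token are covered). The output is determined by
the contents of the memory at the end of the last pass. -/
structure StreamAlg (τ β : Type*) (s : ℕ) where
  /-- the initial contents of the memory -/
  init : Fin (2 ^ s)
  /-- `step k i m e` is the new memory when the token `e` is read at position `i` of pass `k`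
  with memory `m` -/
  step : ℕ → ℕ → Fin (2 ^ s) → τ → Fin (2 ^ s)
  /-- the output as a function of the final memory -/
  output : Fin (2 ^ s) → β

namespace StreamAlg

variable {τ β : Type*} {s : ℕ}

/-- Read the tokens of a list in pass `k`, the first of them being at position `i`. -/
def readFrom (A : StreamAlg τ β s) (k : ℕ) : ℕ → List τ → Fin (2 ^ s) → Fin (2 ^ s)
  | _, [], m => m
  | i, e :: l, m => A.readFrom k (i + 1) l (A.step k i m e)

/-- The memory after `p` passes over the stream `l`. -/
def memAfter (A : StreamAlg τ β s) (l : List τ) : ℕ → Fin (2 ^ s)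
  | 0 => A.init
  | k + 1 => A.readFrom k 0 l (A.memAfter l k)

/-- The output after `p` passes over the stream `l`. -/
def run (A : StreamAlg τ β s) (p : ℕ) (l : List τ) : β :=
  A.output (A.memAfter l p)

end StreamAlg

/-- `A` solves the problem `Q` on `n`-vertex tournaments in `p` passes, deterministically. -/
def Solves {n : ℕ} {β : Type*} {s : ℕ} (Q : Digraph (Fin n) → β → Prop) (p : ℕ)
    (A : StreamAlg (Fin n × Fin n) β s) : Prop :=
  ∀ G : Digraph (Fin n), IsTournament G → ∀ l, IsStreamOf G l → Q G (A.run p l)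

/-- A randomized algorithm is a deterministic algorithm `A ω` chosen according to the random
outcome `ω` of a probability space. It solves `Q` on `n`-vertex tournaments in `p` passes if, for
each tournament and each order of its edges, it errs with probability at most `1/3`. -/
def RandSolves {n : ℕ} {β : Type*} {s : ℕ} (Q : Digraph (Fin n) → β → Prop) (p : ℕ)
    {Ω : Type u} [MeasurableSpace Ω] (μ : MeasureTheory.Measure Ω)
    (A : Ω → StreamAlg (Fin n × Fin n) β s) : Prop :=
  ∀ G : Digraph (Fin n), IsTournament G → ∀ l, IsStreamOf G l →
    μ {ω | ¬ Q G ((A ω).run p l)} ≤ 1 / 3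

/-! ### A uniform machine model for one-pass algorithms

A random access machine whose input is read once, token by token. All of its working memory,
also between two tokens and after the last one, is visible in its configurations. -/

/-- Instructions; `a`, `b`, `c` are addresses of memory cells and `t` is a program line. -/
inductive Instr where
  /-- `M[a] := k` -/
  | const (a k : ℕ)
  /-- `M[a] := M[b] + M[c]` -/
  | add (a b c : ℕ)
  /-- `M[a] := M[M[b]]` -/
  | load (a b : ℕ)
  /-- `M[M[a]] := M[b]` -/
  | store (a b : ℕ)
  /-- jump to line `t` if `M[a] = M[b]` -/
  | jumpEq (a b t : ℕ)
  /-- read the next token `(x, y)` of the stream, `M[a] := x` and `M[b] := y` in this order;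
  jump to line `t` if the stream is exhausted -/
  | next (a b t : ℕ)
  /-- stop, with the given answer -/
  | halt (answer : Bool)

/-- A configuration: the program line, the memory, and the part of the stream not yet read. -/
structure Config where
  line : ℕ
  mem : ℕ → ℕ
  rest : List (ℕ × ℕ)

/-- One step of the program `P`; nothing changes after the machine has stopped (by `halt` or
by leaving the program). -/
def step (P : List Instr) (c : Config) : Config :=
  match P[c.line]? with
  | none => c
  | some (.const a k) => ⟨c.line + 1, Function.update c.mem a k, c.rest⟩
  | some (.add a b d) => ⟨c.line + 1, Function.update c.mem a (c.mem b + c.mem d), c.rest⟩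
  | some (.load a b) => ⟨c.line + 1, Function.update c.mem a (c.mem (c.mem b)), c.rest⟩
  | some (.store a b) => ⟨c.line + 1, Function.update c.mem (c.mem a) (c.mem b), c.rest⟩
  | some (.jumpEq a b t) => ⟨if c.mem a = c.mem b then t else c.line + 1, c.mem, c.rest⟩
  | some (.next a b t) =>
    match c.rest with
    | [] => ⟨t, c.mem, []⟩
    | e :: l => ⟨c.line + 1, Function.update (Function.update c.mem a e.1) b e.2, l⟩
  | some (.halt _) => c

/-- The start of the machine on an `n`-vertex graph stream: cell `0` holds `n`, all other cells
hold `0`. -/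
def start {n : ℕ} (l : List (Fin n × Fin n)) : Config :=
  ⟨0, Function.update (fun _ => 0) 0 n, l.map fun e => (e.1.val, e.2.val)⟩

/-- The configuration after `t` steps. -/
def configAt (P : List Instr) {n : ℕ} (l : List (Fin n × Fin n)) (t : ℕ) : Config :=
  (step P)^[t] (start l)

/-- The program `P` stops on the stream `l` with the answer `b`. -/
def Answers (P : List Instr) {n : ℕ} (l : List (Fin n × Fin n)) (b : Bool) : Prop :=
  ∃ t, P[(configAt P l t).line]? = some (.halt b)

/-- Throughout its run on `l`, the program `P` uses only the first `m` memory cells,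
and never holds more than `w` bits in a cell: it works in `m * w` bits of memory. -/
def WorksIn (P : List Instr) {n : ℕ} (l : List (Fin n × Fin n)) (m w : ℕ) : Prop :=
  ∀ t, (∀ a, m ≤ a → (configAt P l t).mem a = 0) ∧ ∀ a, (configAt P l t).mem a < 2 ^ w

end TournamentStream

/-!
A tournament is acyclic if and only if its in-degrees are pairwise distinct, so it is enough to
keep one counter per vertex.

The lower bounds reduce from set disjointness. Reverse in the transitive tournament the edges
between `3 * i` and `3 * i + 1` where `x i` holds, and those between `3 * i + 1` and `3 * i + 2`
where `y i` holds: a cycle arises if and only if `x` and `y` meet. An approximation of the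
size of a minimum feedback arc set tells whether this size is zero, hence decides acyclicity.

For disjointness, distribute the bits of a uniform point `z` among the two players, so that each
coordinate belongs to only one of them, and plant the same bit in both inputs at a coordinate `i`.
The transcript distributions for the planted bits `0, 0` and `1, 1` have to be far apart in
Hellinger distance; by the cut-and-paste property this distance is bounded by how well the bit
`z i`, given to either one of the players, can be told from the transcript. A transcript that has
probability `q` confines `z` to a set of density `q`, whose Fourier weight on level one is at most
`2 * q ^ 2 * log (1 / q)`, so summing over `i` bounds the number of coordinates by a multiple of
the logarithm of the number of transcripts.
-/

namespace TournamentStream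

open Finset

/-! ### In-degrees and feedback arc sets -/

section Tournaments

variable {V : Type*} {G : Digraph V}

/-- The in-degree of a vertex (`0` if it has infinitely many in-neighbours). -/
noncomputable def inDeg (G : Digraph V) (v : V) : ℕ :=
  {w | G.Adj w v}.ncard

lemma isAcyclic_of_adj_lt {α : Type*} [Preorder α] {r : V → α}
    (hr : ∀ ⦃u v⦄, G.Adj u v → r u < r v) : IsAcyclic G := fun v hv =>
  lt_irrefl (r v) (by simpa only [Relation.transGen_eq_self] using
    Relation.TransGen.lift r (p := (· < ·)) (fun _ _ h => hr h) v v hv)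

lemma IsTournament.adj_trans (hG : IsTournament G) (hA : IsAcyclic G) {u v w : V}
    (huv : G.Adj u v) (hvw : G.Adj v w) : G.Adj u w := by
  have huvw : Relation.TransGen G.Adj u w := .tail (.single huv) hvw
  have hne : u ≠ w := by
    rintro rfl
    exact hA u huvw
  exact (hG.2 u w hne).or.resolve_right fun hwu => hA u (huvw.tail hwu)

lemma ncard_setOf_lt_of_injective {f : V → ℕ} (hf : f.Injective) (hlt : ∀ v, f v < Nat.card V)
    {d : ℕ} (hd : d ≤ Nat.card V) : {v | f v < d}.ncard = d := by
  have hrange : Set.range f = Set.Iio (Nat.card V) :=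
    Set.eq_of_subset_of_ncard_le (Set.range_subset_iff.2 hlt)
      (by rw [Set.ncard_Iio_nat, Set.ncard_range_of_injective hf])
  have himage : f '' {v | f v < d} = Set.Iio d := by
    rw [← Set.preimage_ofPred_eq (p := (· < d)), Set.image_preimage_eq_inter_range, hrange]
    exact Set.inter_eq_left.2 (Set.Iio_subset_Iio hd)
  rw [← Set.ncard_image_of_injective _ hf, himage, Set.ncard_Iio_nat]

variable [Finite V]

lemma IsTournament.inDeg_lt_card (hG : IsTournament G) (v : V) : inDeg G v < Nat.card V := by
  rw [← Set.ncard_univ]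
  exact Set.ncard_lt_ncard (Set.ssubset_univ_iff.2 fun h => hG.1 v (h.symm ▸ Set.mem_univ v :))

lemma IsTournament.inDeg_lt_inDeg (hG : IsTournament G) (hA : IsAcyclic G) {u v : V}
    (huv : G.Adj u v) : inDeg G u < inDeg G v :=
  Set.ncard_lt_ncard ⟨fun _ hw => hG.adj_trans hA hw huv, fun h => hG.1 u (h huv)⟩

lemma IsTournament.adj_iff_inDeg_lt (hG : IsTournament G) (hinj : (inDeg G).Injective) (u v : V) :
    G.Adj u v ↔ inDeg G u < inDeg G v := by
  induction hd : inDeg G v using Nat.strong_induction_on generalizing u v with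
  | _ d ih =>
    have hsub : {w | inDeg G w < d} ⊆ {w | G.Adj w v} := by
      intro w (hw : inDeg G w < d)
      have hne : w ≠ v := by
        rintro rfl
        exact hw.ne hd
      refine (hG.2 w v hne).or.resolve_right fun hvw => ?_
      exact ((ih _ hw v w rfl).1 hvw).not_gt (hd.symm ▸ hw)
    have hcard : {w | inDeg G w < d}.ncard = d :=
      ncard_setOf_lt_of_injective hinj hG.inDeg_lt_card (hd ▸ (hG.inDeg_lt_card v).le)
    have heq := Set.eq_of_subset_of_ncard_le hsub (hcard.trans hd.symm).ge
    exact (Set.ext_iff.1 heq u).symm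

lemma IsTournament.isAcyclic_iff_injective_inDeg (hG : IsTournament G) :
    IsAcyclic G ↔ (inDeg G).Injective := by
  refine ⟨fun hA u v huv => ?_, fun h => isAcyclic_of_adj_lt fun u v =>
    (hG.adj_iff_inDeg_lt h u v).1⟩
  by_contra hne
  rcases (hG.2 u v hne).or with h | h
  · exact (hG.inDeg_lt_inDeg hA h).ne huv
  · exact (hG.inDeg_lt_inDeg hA h).ne' huv

end Tournaments

section FeedbackArcSet

variable {n : ℕ} {G : Digraph (Fin n)}

lemma fasSize_eq_zero_iff : fasSize G = 0 ↔ ∃ σ, backEdges G σ = ∅ := by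
  rw [fasSize, iInf, Nat.sInf_eq_zero, or_iff_left (Set.range_nonempty _).ne_empty]
  exact exists_congr fun σ => Set.ncard_eq_zero

lemma IsTournament.fasSize_eq_zero_iff_isAcyclic (hG : IsTournament G) :
    fasSize G = 0 ↔ IsAcyclic G := by
  rw [fasSize_eq_zero_iff]
  constructor
  · rintro ⟨σ, hσ⟩
    refine isAcyclic_of_adj_lt (r := σ) fun u v huv => lt_of_not_ge fun hle => ?_
    have hne : σ v ≠ σ u := fun h => hG.1 u (σ.injective h ▸ huv :)
    exact Set.eq_empty_iff_forall_notMem.1 hσ (u, v) ⟨huv, hle.lt_of_ne hne⟩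
  · intro hA
    have hlt : ∀ v, inDeg G v < n := fun v => by simpa only [Nat.card_fin] using hG.inDeg_lt_card v
    have hinj : Function.Injective fun v => (⟨inDeg G v, hlt v⟩ : Fin n) :=
      fun u v h => hG.isAcyclic_iff_injective_inDeg.1 hA (Fin.mk.inj_iff.1 h)
    refine ⟨.ofBijective _ (Finite.injective_iff_bijective.1 hinj), ?_⟩
    exact Set.eq_empty_of_forall_notMem fun _ h => (hG.inDeg_lt_inDeg hA h.1).asymm h.2

lemma fasSizeApprox.acyc {α : ℝ} (hG : IsTournament G) {b : ℤ} (h : fasSizeApprox α G b) :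
    acyc G (decide (b = 0)) := by
  obtain ⟨hlower, hupper⟩ := h
  rw [TournamentStream.acyc, decide_eq_true_iff, ← hG.fasSize_eq_zero_iff_isAcyclic]
  constructor
  · rintro rfl
    exact_mod_cast hlower.antisymm (by simp)
  · intro h0
    rw [h0, Nat.cast_zero] at hlower hupper
    exact_mod_cast (hupper.trans_eq (mul_zero α)).antisymm hlower

lemma IsStreamOf.countP_eq_inDeg {l : List (Fin n × Fin n)} (hl : IsStreamOf G l) (v : Fin n) :
    l.countP (fun e => e.2 = v) = inDeg G v := by
  have himage : (·, v) '' {w | G.Adj w v} = (l.filter fun e => e.2 = v).toFinset := by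
    ext ⟨u, w⟩
    simp only [Set.mem_image, Set.mem_ofPred_eq, Prod.mk.injEq, List.coe_toFinset, List.mem_filter,
      decide_eq_true_eq, hl.2]
    aesop
  rw [inDeg, ← Set.ncard_image_of_injective _ (Prod.mk_left_injective v), himage,
    Set.ncard_coe_finset, List.toFinset_card_of_nodup (hl.1.filter _), List.countP_eq_length_filter]

end FeedbackArcSet

section CountingAlgorithm

lemma natLog_add_le_mul_log {n : ℕ} (hn : 2 ≤ n) {c : ℝ} (hc : 0 ≤ c) :
    Nat.log 2 n + c ≤ (1 + c) / Real.log 2 * Real.log n := by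
  have hlog : (Nat.log 2 n : ℝ) ≤ Real.log n / Real.log 2 := Real.natLog_le_logb n 2
  have hone : 1 ≤ Real.log n / Real.log 2 :=
    (one_le_div (Real.log_pos one_lt_two)).2 (Real.log_le_log two_pos (by exact_mod_cast hn))
  calc Nat.log 2 n + c
      ≤ Real.log n / Real.log 2 + c * (Real.log n / Real.log 2) :=
        add_le_add hlog (le_mul_of_one_le_right hc hone)
    _ = (1 + c) / Real.log 2 * Real.log n := by ring

lemma exists_streamAlg_run_one_eq_foldl {τ β S : Type*} [Fintype S] {s : ℕ}
    (hS : Fintype.card S ≤ 2 ^ s) (init : S) (step : S → τ → S) (output : S → β) :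
    ∃ A : StreamAlg τ β s, ∀ l, A.run 1 l = output (l.foldl step init) := by
  have : Nonempty S := ⟨init⟩
  obtain ⟨enc⟩ : Nonempty (S ↪ Fin (2 ^ s)) :=
    Function.Embedding.nonempty_of_card_le (by simpa only [Fintype.card_fin] using hS)
  let dec := Function.invFun enc
  have hdec : ∀ x, dec (enc x) = x := Function.leftInverse_invFun enc.injective
  let A : StreamAlg τ β s :=
    ⟨enc init, fun _ _ m e => enc (step (dec m) e), fun m => output (dec m)⟩
  have hread : ∀ l i x, A.readFrom 0 i l (enc x) = enc (l.foldl step x) := by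
    intro l
    induction l with
    | nil => exact fun _ _ => rfl
    | cons e l ih => exact fun i x => by simp only [StreamAlg.readFrom, A, hdec, List.foldl, ih]
  refine ⟨A, fun l => ?_⟩
  change output (dec (A.readFrom 0 0 l (enc init))) = _
  rw [hread, hdec]

lemma foldl_add_single_apply {V κ R : Type*} [DecidableEq V] [AddMonoidWithOne R] (g : κ → V)
    (l : List κ) (f : V → R) (v : V) :
    l.foldl (fun f e => f + Pi.single (g e) 1) f v = f v + (l.countP fun e => g e = v : ℕ) := by
  induction l generalizing f with
  | nil => simp
  | cons e l ih =>
    rw [List.foldl_cons, ih, List.countP_cons, add_comm (l.countP _), Nat.cast_add, ← add_assoc]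
    by_cases hv : g e = v
    · subst hv
      simp
    · simp [hv]

lemma IsTournament.injective_natCast_inDeg_iff {n : ℕ} {G : Digraph (Fin n)}
    (hG : IsTournament G) :
    (Function.Injective fun v => (inDeg G v : ZMod n)) ↔ (inDeg G).Injective := by
  have hlt : ∀ v, inDeg G v < n := fun v => by simpa only [Nat.card_fin] using hG.inDeg_lt_card v
  simp only [Function.Injective, ZMod.natCast_eq_natCast_iff', Nat.mod_eq_of_lt (hlt _)]

theorem exists_solves_acyc : ∃ C : ℝ, ∀ n : ℕ, 2 ≤ n → ∃ s : ℕ,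
    (s : ℝ) ≤ C * (n * Real.log n) ∧
      ∃ A : StreamAlg (Fin n × Fin n) Bool s, Solves acyc 1 A := by
  refine ⟨(1 + 1) / Real.log 2, fun n hn => ⟨(Nat.log 2 n + 1) * n, ?_, ?_⟩⟩
  · calc (((Nat.log 2 n + 1) * n : ℕ) : ℝ)
        ≤ (1 + 1) / Real.log 2 * Real.log n * n := by
          push_cast
          gcongr
          exact natLog_add_le_mul_log hn zero_le_one
      _ = (1 + 1) / Real.log 2 * (n * Real.log n) := by ring
  · have : NeZero n := ⟨by omega⟩
    have hcard : Fintype.card (Fin n → ZMod n) ≤ 2 ^ ((Nat.log 2 n + 1) * n) := by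
      rw [Fintype.card_fun, ZMod.card, Fintype.card_fin, pow_mul]
      exact Nat.pow_le_pow_left (Nat.lt_pow_succ_log_self one_lt_two n).le n
    obtain ⟨A, hA⟩ := exists_streamAlg_run_one_eq_foldl (τ := Fin n × Fin n) hcard 0
      (fun f e => f + Pi.single e.2 1) fun f => decide f.Injective
    refine ⟨A, fun G hG l hl => ?_⟩
    have hfoldl : l.foldl (fun f e => f + Pi.single e.2 1) 0 = fun v => (inDeg G v : ZMod n) :=
      funext fun v => by
        rw [foldl_add_single_apply, hl.countP_eq_inDeg, Pi.zero_apply, zero_add]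
    rw [hA, acyc, decide_eq_true_iff, hfoldl, hG.injective_natCast_inDeg_iff,
      hG.isAcyclic_iff_injective_inDeg]

end CountingAlgorithm

/-! ### The random access machine -/

section Runs

variable {P : List Instr} {m w : ℕ} {c c' : Config}

/-- The memory `M` is zero outside the first `m` cells and holds at most `w` bits in each cell. -/
def MemWithin (m w : ℕ) (M : ℕ → ℕ) : Prop :=
  (∀ a, m ≤ a → M a = 0) ∧ ∀ a, M a < 2 ^ w

/-- The program `P` leads from one configuration to another, with a memory that stays within the
bounds `m` and `w` at all configurations before the last one. -/
def Runs (P : List Instr) (m w : ℕ) : Config → Config → Prop :=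
  Relation.ReflTransGen fun c c' => MemWithin m w c.mem ∧ step P c = c'

instance : IsTrans Config (Runs P m w) := inferInstanceAs (IsTrans _ (Relation.ReflTransGen _))

lemma MemWithin.update {M : ℕ → ℕ} (h : MemWithin m w M) {a v : ℕ} (ha : a < m) (hv : v < 2 ^ w) :
    MemWithin m w (Function.update M a v) :=
  ⟨fun b hb => by rw [Function.update_of_ne (by omega), h.1 b hb],
    (Function.forall_update_iff M fun _ k => k < 2 ^ w).2 ⟨hv, fun b _ => h.2 b⟩⟩

lemma Runs.of_step (hc : MemWithin m w c.mem) (h : step P c = c') : Runs P m w c c' :=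
  .single ⟨hc, h⟩

lemma Runs.exists_iterate (h : Runs P m w c c') : ∃ t, (step P)^[t] c = c' := by
  induction h using Relation.ReflTransGen.head_induction_on with
  | refl => exact ⟨0, rfl⟩
  | head h _ ih =>
    obtain ⟨t, ht⟩ := ih
    exact ⟨t + 1, by rw [Function.iterate_succ_apply, h.2, ht]⟩

lemma Runs.memWithin_iterate {b : Bool} (h : Runs P m w c c') (hc' : MemWithin m w c'.mem)
    (hb : P[c'.line]? = some (.halt b)) (t : ℕ) : MemWithin m w ((step P)^[t] c).mem := by
  induction h using Relation.ReflTransGen.head_induction_on generalizing t with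
  | refl => rwa [Function.iterate_fixed (by rw [step, hb])]
  | head h _ ih =>
    cases t with
    | zero => exact h.1
    | succ t => simpa only [Function.iterate_succ_apply, h.2] using ih t

end Runs

section Program

/-- The program deciding acyclicity. The cells `9 + v` count the edges into `v`; afterwards the
cells `9 + n + d` mark the in-degrees `d` already seen, and the answer is `false` as soon as one of
them is seen twice. See `MachineState` for the registers. -/
def acycProgram : List Instr :=
  [ .const 5 1,       -- 0
    .const 6 9,       -- 1
    .add 8 6 0,       -- 2
    .next 1 2 9,      -- 3
    .add 3 6 2,       -- 4
    .load 4 3,        -- 5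
    .add 4 4 5,       -- 6
    .store 3 4,       -- 7
    .jumpEq 0 0 3,    -- 8
    .jumpEq 7 0 18,   -- 9
    .add 3 6 7,       -- 10
    .load 4 3,        -- 11
    .add 3 8 4,       -- 12
    .load 4 3,        -- 13
    .jumpEq 4 5 19,   -- 14
    .store 3 5,       -- 15
    .add 7 7 5,       -- 16
    .jumpEq 0 0 9,    -- 17
    .halt true,       -- 18
    .halt false ]     -- 19

/-- The variable contents of the memory of `acycProgram` once its constants are initialized: the
last token, two scratch registers, the loop counter, the counters and the marks. -/
structure MachineState where
  src : ℕ
  tgt : ℕ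
  addr : ℕ
  val : ℕ
  pos : ℕ
  deg : ℕ → ℕ
  seen : ℕ → ℕ

namespace MachineState

/-- The memory of the machine in the state `S`, for graphs with `n` vertices. -/
def mem (n : ℕ) (S : MachineState) : ℕ → ℕ
  | 0 => n
  | 1 => S.src
  | 2 => S.tgt
  | 3 => S.addr
  | 4 => S.val
  | 5 => 1
  | 6 => 9
  | 7 => S.pos
  | 8 => 9 + n
  | a + 9 => if a < n then S.deg a else if a < 2 * n then S.seen (a - n) else 0

variable {n w : ℕ} (S : MachineState)

lemma mem_deg {v : ℕ} (hv : v < n) : S.mem n (9 + v) = S.deg v := by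
  rw [add_comm, mem, if_pos hv]

lemma mem_seen {d : ℕ} (hd : d < n) : S.mem n (9 + n + d) = S.seen d := by
  rw [add_assoc, add_comm, mem, if_neg (by omega), if_pos (by omega), Nat.add_sub_cancel_left]

lemma update_src_tgt (u v : ℕ) : Function.update (Function.update (S.mem n) 1 u) 2 v =
    mem n {S with src := u, tgt := v} := by
  funext a
  match a with
  | 0 | 1 | 2 | 3 | 4 | 5 | 6 | 7 | 8 | _ + 9 => rfl

lemma update_addr (v : ℕ) : Function.update (S.mem n) 3 v = mem n {S with addr := v} := by
  funext a
  match a with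
  | 0 | 1 | 2 | 3 | 4 | 5 | 6 | 7 | 8 | _ + 9 => rfl

lemma update_val (v : ℕ) : Function.update (S.mem n) 4 v = mem n {S with val := v} := by
  funext a
  match a with
  | 0 | 1 | 2 | 3 | 4 | 5 | 6 | 7 | 8 | _ + 9 => rfl

lemma update_pos (v : ℕ) : Function.update (S.mem n) 7 v = mem n {S with pos := v} := by
  funext a
  match a with
  | 0 | 1 | 2 | 3 | 4 | 5 | 6 | 7 | 8 | _ + 9 => rfl

lemma update_deg {v : ℕ} (hv : v < n) (k : ℕ) : Function.update (S.mem n) (9 + v) k =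
    mem n {S with deg := Function.update S.deg v k} := by
  funext a
  match a with
  | 0 | 1 | 2 | 3 | 4 | 5 | 6 | 7 | 8 => rw [Function.update_of_ne (by omega)]; rfl
  | a + 9 => grind [Function.update_apply, mem]

lemma update_seen {d : ℕ} (hd : d < n) (k : ℕ) : Function.update (S.mem n) (9 + n + d) k =
    mem n {S with seen := Function.update S.seen d k} := by
  funext a
  match a with
  | 0 | 1 | 2 | 3 | 4 | 5 | 6 | 7 | 8 => rw [Function.update_of_ne (by omega)]; rfl
  | a + 9 => grind [Function.update_apply, mem]

/-- All entries of the state are less than `B`. -/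
structure Fits (B : ℕ) (S : MachineState) : Prop where
  src_lt : S.src < B
  tgt_lt : S.tgt < B
  addr_lt : S.addr < B
  val_lt : S.val < B
  pos_lt : S.pos < B
  deg_lt : ∀ v, S.deg v < B
  seen_lt : ∀ d, S.seen d < B

variable {S}

lemma Fits.memWithin (hS : S.Fits (2 ^ w)) (hw : 9 + n < 2 ^ w) :
    MemWithin (9 + 2 * n) w (S.mem n) := by
  constructor
  · intro a ha
    obtain ⟨a, rfl⟩ := Nat.exists_eq_add_of_le' (le_self_add.trans ha : 9 ≤ a)
    rw [mem, if_neg (by omega), if_neg (by omega)]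
  · intro a
    match a with
    | 0 => exact (Nat.le_add_left n 9).trans_lt hw
    | 1 => exact hS.src_lt
    | 2 => exact hS.tgt_lt
    | 3 => exact hS.addr_lt
    | 4 => exact hS.val_lt
    | 5 => exact (by omega : 1 ≤ 9 + n).trans_lt hw
    | 6 => exact (Nat.le_add_right 9 n).trans_lt hw
    | 7 => exact hS.pos_lt
    | 8 => exact hw
    | a + 9 =>
      rw [mem]
      split_ifs
      exacts [hS.deg_lt a, hS.seen_lt _, by positivity]

end MachineState

section Execution

open MachineState

variable {n w : ℕ} {S : MachineState} {l : List (ℕ × ℕ)}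

lemma MachineState.Fits.runs_of_step (hw : 9 + 2 * n < 2 ^ w) (hS : S.Fits (2 ^ w)) {i : ℕ}
    {c : Config} (h : step acycProgram ⟨i, S.mem n, l⟩ = c) :
    Runs acycProgram (9 + 2 * n) w ⟨i, S.mem n, l⟩ c :=
  .of_step (hS.memWithin (by omega)) h

lemma runs_readToken (hw : 9 + 2 * n < 2 ^ w) (hS : S.Fits (2 ^ w)) {u v : ℕ} (hu : u < n)
    (hv : v < n) (hdeg : S.deg v < n) :
    ∃ S' : MachineState, S'.Fits (2 ^ w) ∧ S'.pos = S.pos ∧ S'.seen = S.seen ∧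
      S'.deg = Function.update S.deg v (S.deg v + 1) ∧
      Runs acycProgram (9 + 2 * n) w ⟨3, S.mem n, (u, v) :: l⟩ ⟨3, S'.mem n, l⟩ := by
  let S₄ := {S with src := u, tgt := v}
  let S₅ := {S₄ with addr := 9 + v}
  let S₆ := {S₅ with val := S.deg v}
  let S₇ := {S₅ with val := S.deg v + 1}
  let S₈ := {S₇ with deg := Function.update S.deg v (S.deg v + 1)}
  have h₄ : S₄.Fits (2 ^ w) := {hS with src_lt := by lia, tgt_lt := by lia}
  have h₅ : S₅.Fits (2 ^ w) := {h₄ with addr_lt := by lia}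
  have h₆ : S₆.Fits (2 ^ w) := {h₅ with val_lt := hS.deg_lt v}
  have h₇ : S₇.Fits (2 ^ w) := {h₅ with val_lt := by lia}
  have h₈ : S₈.Fits (2 ^ w) := {h₇ with
    deg_lt := (Function.forall_update_iff _ fun _ k => k < 2 ^ w).2
      ⟨h₇.val_lt, fun v _ => hS.deg_lt v⟩}
  refine ⟨S₈, h₈, rfl, rfl, rfl, ?_⟩
  have hload : Function.update (S₅.mem n) 4 (S₅.mem n (9 + v)) = S₆.mem n := by
    rw [S₅.mem_deg hv, S₅.update_val]
  calc Runs acycProgram (9 + 2 * n) w ⟨3, S.mem n, (u, v) :: l⟩ ⟨4, S₄.mem n, l⟩ :=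
        hS.runs_of_step hw (congrArg (Config.mk 4 · l) (S.update_src_tgt u v))
    Runs _ _ _ _ ⟨5, S₅.mem n, l⟩ :=
      h₄.runs_of_step hw (congrArg (Config.mk 5 · l) (S₄.update_addr _))
    Runs _ _ _ _ ⟨6, S₆.mem n, l⟩ :=
      h₅.runs_of_step hw (congrArg (Config.mk 6 · l) hload)
    Runs _ _ _ _ ⟨7, S₇.mem n, l⟩ :=
      h₆.runs_of_step hw (congrArg (Config.mk 7 · l) (S₆.update_val _))
    Runs _ _ _ _ ⟨8, S₈.mem n, l⟩ :=
      h₇.runs_of_step hw (congrArg (Config.mk 8 · l) (S₇.update_deg hv _))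
    Runs _ _ _ _ ⟨3, S₈.mem n, l⟩ := h₈.runs_of_step hw (congrArg (Config.mk · _ l) (if_pos rfl))

lemma runs_readAll (hw : 9 + 2 * n < 2 ^ w) (hS : S.Fits (2 ^ w))
    (hl : ∀ e ∈ l, e.1 < n ∧ e.2 < n)
    (hdeg : ∀ v < n, S.deg v + l.countP (fun e => e.2 = v) < n) :
    ∃ S' : MachineState, S'.Fits (2 ^ w) ∧ S'.pos = S.pos ∧ S'.seen = S.seen ∧
      S'.deg = (fun v => S.deg v + l.countP fun e => e.2 = v) ∧
      Runs acycProgram (9 + 2 * n) w ⟨3, S.mem n, l⟩ ⟨9, S'.mem n, []⟩ := by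
  induction l generalizing S with
  | nil => exact ⟨S, hS, rfl, rfl, rfl, hS.runs_of_step hw rfl⟩
  | cons e l ih =>
    obtain ⟨u, v⟩ := e
    obtain ⟨⟨hu, hv⟩, hl⟩ := List.forall_mem_cons.1 hl
    obtain ⟨S', hS', hpos', hseen', hdeg', hrun'⟩ :=
      runs_readToken (l := l) hw hS hu hv ((Nat.le_add_right _ _).trans_lt (hdeg v hv))
    have hcount : ∀ x, S'.deg x + l.countP (fun e => e.2 = x) =
        S.deg x + ((u, v) :: l).countP fun e => e.2 = x := by
      intro x
      rw [hdeg', List.countP_cons, Function.update_apply]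
      grind
    obtain ⟨S'', hS'', hpos'', hseen'', hdeg'', hrun''⟩ :=
      ih hS' hl fun x hx => (hcount x).trans_lt (hdeg x hx)
    exact ⟨S'', hS'', hpos''.trans hpos', hseen''.trans hseen', hdeg''.trans (funext hcount),
      hrun'.trans hrun''⟩

lemma runs_lookup (hw : 9 + 2 * n < 2 ^ w) (hS : S.Fits (2 ^ w)) (hpos : S.pos < n)
    (hdeg : S.deg S.pos < n) :
    ∃ S' : MachineState, S'.Fits (2 ^ w) ∧
      S' = {S with addr := 9 + n + S.deg S.pos, val := S.seen (S.deg S.pos)} ∧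
      Runs acycProgram (9 + 2 * n) w ⟨9, S.mem n, l⟩ ⟨14, S'.mem n, l⟩ := by
  let S₁₁ := {S with addr := 9 + S.pos}
  let S₁₂ := {S₁₁ with val := S.deg S.pos}
  let S₁₃ := {S₁₂ with addr := 9 + n + S.deg S.pos}
  let S₁₄ := {S₁₃ with val := S.seen (S.deg S.pos)}
  have h₁₁ : S₁₁.Fits (2 ^ w) := {hS with addr_lt := by lia}
  have h₁₂ : S₁₂.Fits (2 ^ w) := {h₁₁ with val_lt := hS.deg_lt _}
  have h₁₃ : S₁₃.Fits (2 ^ w) := {h₁₂ with addr_lt := by lia}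
  have h₁₄ : S₁₄.Fits (2 ^ w) := {h₁₃ with val_lt := hS.seen_lt _}
  have hdegLoad : Function.update (S₁₁.mem n) 4 (S₁₁.mem n (9 + S.pos)) = S₁₂.mem n := by
    rw [S₁₁.mem_deg hpos, S₁₁.update_val]
  have hseenLoad : Function.update (S₁₃.mem n) 4 (S₁₃.mem n (9 + n + S.deg S.pos)) =
      S₁₄.mem n := by
    rw [S₁₃.mem_seen hdeg, S₁₃.update_val]
  refine ⟨S₁₄, h₁₄, rfl, ?_⟩
  calc Runs acycProgram (9 + 2 * n) w ⟨9, S.mem n, l⟩ ⟨10, S.mem n, l⟩ :=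
        hS.runs_of_step hw (congrArg (Config.mk · _ l) (if_neg hpos.ne))
    Runs _ _ _ _ ⟨11, S₁₁.mem n, l⟩ :=
      hS.runs_of_step hw (congrArg (Config.mk 11 · l) (S.update_addr _))
    Runs _ _ _ _ ⟨12, S₁₂.mem n, l⟩ :=
      h₁₁.runs_of_step hw (congrArg (Config.mk 12 · l) hdegLoad)
    Runs _ _ _ _ ⟨13, S₁₃.mem n, l⟩ :=
      h₁₂.runs_of_step hw (congrArg (Config.mk 13 · l) (S₁₂.update_addr _))
    Runs _ _ _ _ ⟨14, S₁₄.mem n, l⟩ :=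
      h₁₃.runs_of_step hw (congrArg (Config.mk 14 · l) hseenLoad)

lemma runs_mark (hw : 9 + 2 * n < 2 ^ w) (hS : S.Fits (2 ^ w)) {d : ℕ} (hd : d < n)
    (haddr : S.addr = 9 + n + d) (hval : S.val ≠ 1) (hpos : S.pos < n) :
    ∃ S' : MachineState, S'.Fits (2 ^ w) ∧ S'.pos = S.pos + 1 ∧ S'.deg = S.deg ∧
      S'.seen = Function.update S.seen d 1 ∧
      Runs acycProgram (9 + 2 * n) w ⟨14, S.mem n, l⟩ ⟨9, S'.mem n, l⟩ := by
  let S₁₆ := {S with seen := Function.update S.seen d 1}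
  let S₁₇ := {S₁₆ with pos := S.pos + 1}
  have h₁₆ : S₁₆.Fits (2 ^ w) := {hS with
    seen_lt := (Function.forall_update_iff _ fun _ k => k < 2 ^ w).2
      ⟨by omega, fun d _ => hS.seen_lt d⟩}
  have h₁₇ : S₁₇.Fits (2 ^ w) := {h₁₆ with pos_lt := by lia}
  refine ⟨S₁₇, h₁₇, rfl, rfl, rfl, ?_⟩
  have hstore : Function.update (S.mem n) S.addr 1 = S₁₆.mem n := by
    rw [haddr, S.update_seen hd]
  calc Runs acycProgram (9 + 2 * n) w ⟨14, S.mem n, l⟩ ⟨15, S.mem n, l⟩ :=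
        hS.runs_of_step hw (congrArg (Config.mk · _ l) (if_neg hval))
    Runs _ _ _ _ ⟨16, S₁₆.mem n, l⟩ := hS.runs_of_step hw (congrArg (Config.mk 16 · l) hstore)
    Runs _ _ _ _ ⟨17, S₁₇.mem n, l⟩ :=
      h₁₆.runs_of_step hw (congrArg (Config.mk 17 · l) (S₁₆.update_pos _))
    Runs _ _ _ _ ⟨9, S₁₇.mem n, l⟩ :=
      h₁₇.runs_of_step hw (congrArg (Config.mk · _ l) (if_pos rfl))

lemma update_indicator_one {α M : Type*} [DecidableEq α] [Zero M] [One M] (A : Set α) (a : α) :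
    Function.update (A.indicator (1 : α → M)) a 1 = (insert a A).indicator 1 := by
  classical
  funext x
  by_cases hx : x = a <;> simp [Set.indicator_apply, hx]

open Classical in
lemma runs_check (hw : 9 + 2 * n < 2 ^ w) (hS : S.Fits (2 ^ w)) (hpos : S.pos ≤ n)
    (hdeg : ∀ v < n, S.deg v < n) (hinj : Set.InjOn S.deg (Set.Iio S.pos))
    (hseen : S.seen = Set.indicator (S.deg '' Set.Iio S.pos) 1) :
    ∃ S' : MachineState, S'.Fits (2 ^ w) ∧
      Runs acycProgram (9 + 2 * n) w ⟨9, S.mem n, l⟩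
        ⟨if Set.InjOn S.deg (Set.Iio n) then 18 else 19, S'.mem n, l⟩ := by
  induction hr : n - S.pos generalizing S with
  | zero =>
    have hpos : S.pos = n := by omega
    refine ⟨S, hS, ?_⟩
    rw [if_pos (hpos ▸ hinj)]
    exact hS.runs_of_step hw (congrArg (Config.mk · _ l) (if_pos hpos))
  | succ r ih =>
    have hpos : S.pos < n := by omega
    obtain ⟨S', hS', rfl, hlookup⟩ := runs_lookup (l := l) hw hS hpos (hdeg _ hpos)
    by_cases hmem : S.deg S.pos ∈ S.deg '' Set.Iio S.pos
    · have hnot : ¬ Set.InjOn S.deg (Set.Iio n) := by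
        obtain ⟨u, hu, hdu⟩ := hmem
        exact fun h => (Set.mem_Iio.1 hu).ne (h (hu.trans hpos) hpos hdu)
      refine ⟨_, hS', hlookup.trans ?_⟩
      rw [if_neg hnot]
      refine hS'.runs_of_step hw (congrArg (Config.mk · _ l) (if_pos ?_))
      exact (congrFun hseen _).trans (Set.indicator_of_mem hmem 1)
    · have hval : S.seen (S.deg S.pos) ≠ 1 := by simp [hseen, hmem]
      obtain ⟨S'', hS'', hpos'', hdeg'', hseen'', hmark⟩ :=
        runs_mark (l := l) hw hS' (hdeg _ hpos) rfl hval hpos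
      have hIio : Set.Iio S''.pos = insert S.pos (Set.Iio S.pos) := by
        rw [hpos'', ← Order.succ_eq_add_one, Order.Iio_succ_eq_insert]
      have hnew : S.pos ∉ Set.Iio S.pos := lt_irrefl S.pos
      have hinj'' : Set.InjOn S''.deg (Set.Iio S''.pos) := by
        rw [hIio, hdeg'', Set.injOn_insert hnew]
        exact ⟨hinj, hmem⟩
      have hindicator : S''.seen = Set.indicator (S''.deg '' Set.Iio S''.pos) 1 := by
        rw [hIio, hdeg'', hseen'', Set.image_insert_eq, ← update_indicator_one, ← hseen]
      obtain ⟨T, hT, hrun⟩ :=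
        ih hS'' (hpos''.trans_le hpos) (by rwa [hdeg'']) hinj'' hindicator (by lia)
      exact ⟨T, hT, hlookup.trans (hmark.trans (by rwa [hdeg''] at hrun))⟩

lemma runs_init (hw : 9 + 2 * n < 2 ^ w) (l : List (Fin n × Fin n)) :
    Runs acycProgram (9 + 2 * n) w (start l)
      ⟨3, mem n ⟨0, 0, 0, 0, 0, 0, 0⟩, l.map fun e => (e.1.val, e.2.val)⟩ := by
  let l' := l.map fun e => (e.1.val, e.2.val)
  let M₀ : ℕ → ℕ := Function.update (fun _ => 0) 0 n
  let M₁ := Function.update M₀ 5 1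
  let M₂ := Function.update M₁ 6 9
  have h₀ : MemWithin (9 + 2 * n) w M₀ :=
    MemWithin.update ⟨fun _ _ => rfl, fun _ => by positivity⟩ (by omega) (by omega)
  have h₁ : MemWithin (9 + 2 * n) w M₁ := h₀.update (by omega) (by omega)
  have h₂ : MemWithin (9 + 2 * n) w M₂ := h₁.update (by omega) (by omega)
  have hmem : Function.update M₂ 8 (9 + n) = mem n ⟨0, 0, 0, 0, 0, 0, 0⟩ := by
    funext a
    match a with
    | 0 | 1 | 2 | 3 | 4 | 5 | 6 | 7 | 8 => rfl
    | _ + 9 => simp [M₀, M₁, M₂, mem]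
  calc Runs acycProgram (9 + 2 * n) w (start l) ⟨1, M₁, l'⟩ := .of_step h₀ rfl
    Runs acycProgram _ _ _ ⟨2, M₂, l'⟩ := .of_step h₁ rfl
    Runs acycProgram _ _ _ ⟨3, mem n ⟨0, 0, 0, 0, 0, 0, 0⟩, l'⟩ :=
      .of_step h₂ (congrArg (Config.mk 3 · l') hmem)

open Classical in
lemma runs_start (hw : 9 + 2 * n < 2 ^ w) {G : Digraph (Fin n)} (hG : IsTournament G)
    {l : List (Fin n × Fin n)} (hl : IsStreamOf G l) :
    ∃ S : MachineState, S.Fits (2 ^ w) ∧ Runs acycProgram (9 + 2 * n) w (start l)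
      ⟨if IsAcyclic G then 18 else 19, S.mem n, []⟩ := by
  have hcount : ∀ v : Fin n,
      (l.map fun e => (e.1.val, e.2.val)).countP (fun e => e.2 = v.val) = inDeg G v := fun v => by
    simp only [← hl.countP_eq_inDeg, List.countP_map, Function.comp_def, Fin.ext_iff]
  have hlt : ∀ v : Fin n, inDeg G v < n := fun v => by
    simpa only [Nat.card_fin] using hG.inDeg_lt_card v
  have hzero : Fits (2 ^ w) ⟨0, 0, 0, 0, 0, 0, 0⟩ := by
    constructor <;> simp
  obtain ⟨S, hS, hpos, hseen, hdeg, hread⟩ := runs_readAll hw hzero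
    (l := l.map fun e => (e.1.val, e.2.val)) (List.forall_mem_map.2 fun e _ => ⟨e.1.2, e.2.2⟩)
    (fun v hv => by simpa only [Pi.zero_apply, zero_add, hcount ⟨v, hv⟩] using hlt ⟨v, hv⟩)
  have hinDeg : ∀ v : Fin n, S.deg v = inDeg G v := fun v => by
    simp only [hdeg, Pi.zero_apply, zero_add, hcount]
  obtain ⟨T, hT, hcheck⟩ := runs_check (l := []) hw hS (by simp [hpos])
    (fun v hv => (hinDeg ⟨v, hv⟩).trans_lt (hlt _)) (by simp [hpos])
    (by simp [hseen, hpos, Pi.zero_def])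
  have hinj : Set.InjOn S.deg (Set.Iio n) ↔ IsAcyclic G := by
    rw [hG.isAcyclic_iff_injective_inDeg, ← funext hinDeg]
    exact ⟨fun h u v huv => Fin.ext (h u.2 v.2 huv),
      fun h u hu v hv huv => congrArg Fin.val (@h ⟨u, hu⟩ ⟨v, hv⟩ huv)⟩
  simp only [hinj] at hcheck
  exact ⟨T, hT, (runs_init hw l).trans (hread.trans hcheck)⟩

theorem exists_program_acyc : ∃ (P : List Instr) (C : ℝ), ∀ n : ℕ, 2 ≤ n →
    ∃ m w : ℕ, ((m * w : ℕ) : ℝ) ≤ C * (n * Real.log n) ∧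
      ∀ G : Digraph (Fin n), IsTournament G → ∀ l, IsStreamOf G l →
        (∃ b, Answers P l b ∧ acyc G b) ∧ WorksIn P l m w := by
  classical
  refine ⟨acycProgram, 7 * ((1 + 5) / Real.log 2), fun n hn =>
    ⟨9 + 2 * n, Nat.log 2 n + 5, ?_, fun G hG l hl => ?_⟩⟩
  · have hcells : (9 + 2 * n : ℝ) ≤ 7 * n := by
      have : (2 : ℝ) ≤ n := by exact_mod_cast hn
      linarith
    calc (((9 + 2 * n) * (Nat.log 2 n + 5) : ℕ) : ℝ)
        ≤ 7 * n * ((1 + 5) / Real.log 2 * Real.log n) := by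
          push_cast
          gcongr
          exact natLog_add_le_mul_log hn (by norm_num)
      _ = 7 * ((1 + 5) / Real.log 2) * (n * Real.log n) := by ring
  · have hw : 9 + 2 * n < 2 ^ (Nat.log 2 n + 5) := by
      have hlog := Nat.lt_pow_succ_log_self one_lt_two n
      rw [pow_add _ (Nat.log 2 n)]
      omega
    obtain ⟨S, hS, hrun⟩ := runs_start hw hG hl
    have hhalt : acycProgram[if IsAcyclic G then 18 else 19]? =
        some (.halt (decide (IsAcyclic G))) := by
      split_ifs with hA <;> simp [hA, acycProgram]
    obtain ⟨t, ht⟩ := hrun.exists_iterate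
    refine ⟨⟨_, ⟨t, ?_⟩, decide_eq_true_iff⟩,
      hrun.memWithin_iterate (hS.memWithin (by omega)) hhalt⟩
    rw [configAt, ht, hhalt]

end Execution

end Program

/-! ### Hellinger distance and subsets of the cube -/

section Hellinger

variable {T : Type*} [Fintype T]

/-- The squared Hellinger distance of two nonnegative weights on a finite set, without the usual
factor `1 / 2`. -/
noncomputable def hellingerSq (a b : T → ℝ) : ℝ :=
  ∑ t, (√(a t) - √(b t)) ^ 2

lemma hellingerSq_le_of_mul_eq_mul {a b c e : T → ℝ} (ha : 0 ≤ a) (hb : 0 ≤ b) (hc : 0 ≤ c)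
    (he : 0 ≤ e) (hmul : b * c = a * e) (hsum : ∑ t, a t + ∑ t, e t = ∑ t, b t + ∑ t, c t) :
    hellingerSq a e ≤ 2 * (hellingerSq a b + hellingerSq a c) := by
  have hterm : ∀ t, (√(a t) - √(e t)) ^ 2 ≤
      2 * ((√(a t) - √(b t)) ^ 2 + (√(a t) - √(c t)) ^ 2) + (a t + e t - (b t + c t)) := fun t => by
    have hsqrt : √(b t) * √(c t) = √(a t) * √(e t) := by
      rw [← Real.sqrt_mul (hb t), ← Real.sqrt_mul (ha t)]
      exact congrArg _ (congrFun hmul t)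
    linarith [sq_nonneg (√(b t) + √(c t) - 2 * √(a t)), Real.sq_sqrt (ha t), Real.sq_sqrt (hb t),
      Real.sq_sqrt (hc t), Real.sq_sqrt (he t)]
  calc hellingerSq a e
      ≤ ∑ t, (2 * ((√(a t) - √(b t)) ^ 2 + (√(a t) - √(c t)) ^ 2) + (a t + e t - (b t + c t))) :=
        sum_le_sum fun t _ => hterm t
    _ = 2 * (hellingerSq a b + hellingerSq a c) := by
        simp only [sum_add_distrib, sum_sub_distrib, ← mul_sum, hsum, sub_self, add_zero,
          hellingerSq]

lemma sub_hellingerSq_le_sum_min {a b : T → ℝ} (ha : 0 ≤ a) (hb : 0 ≤ b) :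
    5 / 12 * (∑ t, a t + ∑ t, b t) - 3 / 2 * hellingerSq a b ≤ ∑ t, min (a t) (b t) := by
  rw [hellingerSq, ← sum_add_distrib, mul_sum, mul_sum, ← sum_sub_distrib]
  refine sum_le_sum fun t _ => ?_
  have hat := Real.sq_sqrt (ha t)
  have hbt := Real.sq_sqrt (hb t)
  refine le_min ?_ ?_
  · nlinarith [sq_nonneg (√(b t) - 18 / 13 * √(a t)), sq_nonneg (√(a t))]
  · nlinarith [sq_nonneg (√(a t) - 18 / 13 * √(b t)), sq_nonneg (√(b t))]

end Hellinger

lemma sq_sqrt_sub_sqrt_le {a b : ℝ} (ha : 0 ≤ a) (hb : 0 ≤ b) :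
    (√a - √b) ^ 2 ≤ (a - b) ^ 2 / (a + b) := by
  rcases (add_nonneg ha hb).eq_or_lt with h | h
  · obtain ⟨rfl, rfl⟩ := (add_eq_zero_iff_of_nonneg ha hb).1 h.symm
    simp
  · have hsub : a - b = (√a - √b) * (√a + √b) := by
      linear_combination -Real.sq_sqrt ha + Real.sq_sqrt hb
    have hadd : a + b ≤ (√a + √b) ^ 2 := by
      linarith [Real.sq_sqrt ha, Real.sq_sqrt hb,
        mul_nonneg (Real.sqrt_nonneg a) (Real.sqrt_nonneg b)]
    rw [le_div_iff₀ h, hsub, mul_pow]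
    gcongr

lemma sum_mul_log_div_le {T : Type*} [Fintype T] {w : T → ℝ} (hw : 0 ≤ w) {N : ℝ}
    (hN : ∑ t, w t = N) : ∑ t, w t * Real.log (N / w t) ≤ N * Real.log (Fintype.card T) := by
  have hterm : ∀ t, w t * Real.log (N / w t) ≤
      w t * Real.log (Fintype.card T) + (N / Fintype.card T - w t) := fun t => by
    have hcard : (0 : ℝ) < Fintype.card T := by exact_mod_cast Fintype.card_pos_iff.2 ⟨t⟩
    have hle : w t ≤ N := hN ▸ single_le_sum (fun t _ => hw t) (mem_univ t)
    rcases (hw t).eq_or_lt with h | (h : 0 < w t)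
    · have : 0 ≤ N / Fintype.card T := div_nonneg (hN ▸ sum_nonneg fun t _ => hw t) hcard.le
      simpa [← h] using this
    · have hN0 : 0 < N := h.trans_le hle
      have hlog := Real.log_le_sub_one_of_pos (x := N / w t / Fintype.card T) (by positivity)
      rw [Real.log_div (by positivity) hcard.ne'] at hlog
      calc w t * Real.log (N / w t)
          ≤ w t * (Real.log (Fintype.card T) + (N / w t / Fintype.card T - 1)) := by
            gcongr; linarith
        _ = _ := by field_simp
  rcases isEmpty_or_nonempty T with _ | _
  · simp
  · refine (sum_le_sum fun t _ => hterm t).trans_eq ?_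
    rw [sum_add_distrib, sum_sub_distrib, ← sum_mul, hN, sum_const, card_univ, nsmul_eq_mul,
      mul_div_cancel₀ N (Nat.cast_ne_zero.2 Fintype.card_ne_zero), sub_self, add_zero]

section Cube

variable {ι : Type*} [Fintype ι]

/-- The bits `false` and `true` as the signs `1` and `-1`. -/
def bitSign (b : Bool) : ℝ :=
  if b then -1 else 1

lemma sum_exp_sum_mul_bitSign_le [DecidableEq ι] (b : ι → ℝ) :
    ∑ z : ι → Bool, Real.exp (∑ i, b i * bitSign (z i)) ≤
      2 ^ Fintype.card ι * Real.exp ((∑ i, b i ^ 2) / 2) := by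
  calc ∑ z : ι → Bool, Real.exp (∑ i, b i * bitSign (z i))
      = ∏ i, ∑ c : Bool, Real.exp (b i * bitSign c) := by
        simp only [prod_univ_sum, Fintype.piFinset_univ, Real.exp_sum]
    _ = ∏ i, 2 * Real.cosh (b i) := by
        simp [Real.cosh_eq, bitSign, add_comm, mul_div_cancel₀]
    _ ≤ ∏ i, 2 * Real.exp (b i ^ 2 / 2) :=
        prod_le_prod (fun i _ => by positivity) fun i _ => by
          gcongr; exact Real.cosh_le_exp_half_sq (b i)
    _ = 2 ^ Fintype.card ι * Real.exp ((∑ i, b i ^ 2) / 2) := by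
        rw [prod_mul_distrib, prod_const, card_univ, sum_div, Real.exp_sum]

-- Jensen's inequality on `F` for the exponential of the linear form with the Fourier coefficients
-- of `F` as weights, compared with the product formula on the whole cube.
lemma sum_sq_sum_bitSign_le (F : Finset (ι → Bool)) :
    ∑ i, (∑ z ∈ F, bitSign (z i)) ^ 2 ≤
      2 * (#F : ℝ) ^ 2 * Real.log (2 ^ Fintype.card ι / #F) := by
  classical
  rcases F.eq_empty_or_nonempty with rfl | hF
  · simp
  have hm : (0 : ℝ) < #F := by exact_mod_cast hF.card_pos
  obtain ⟨b, hb⟩ : ∃ b : ι → ℝ, ∀ i, ∑ z ∈ F, bitSign (z i) = #F * b i :=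
    ⟨fun i => (∑ z ∈ F, bitSign (z i)) / #F, fun i => (mul_div_cancel₀ _ hm.ne').symm⟩
  let B : ℝ := ∑ i, b i ^ 2
  have hmean : ∑ z ∈ F, ∑ i, b i * bitSign (z i) = #F * B := by
    rw [sum_comm, mul_sum]
    refine sum_congr rfl fun i _ => ?_
    rw [← mul_sum, hb]
    ring
  have hjensen : #F * Real.exp B ≤ 2 ^ Fintype.card ι * Real.exp (B / 2) := by
    calc #F * Real.exp B
        = #F * Real.exp (∑ z ∈ F, (#F : ℝ)⁻¹ • ∑ i, b i * bitSign (z i)) := by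
          rw [← smul_sum, hmean, smul_eq_mul, inv_mul_cancel_left₀ hm.ne']
      _ ≤ #F * ∑ z ∈ F, (#F : ℝ)⁻¹ • Real.exp (∑ i, b i * bitSign (z i)) := by
          gcongr
          exact convexOn_exp.map_sum_le (fun _ _ => by positivity) (by simp [hm.ne']) (by simp)
      _ = ∑ z ∈ F, Real.exp (∑ i, b i * bitSign (z i)) := by
          rw [← smul_sum, smul_eq_mul, mul_inv_cancel_left₀ hm.ne']
      _ ≤ ∑ z : ι → Bool, Real.exp (∑ i, b i * bitSign (z i)) :=
          sum_le_sum_of_subset_of_nonneg (subset_univ F) fun _ _ _ => (Real.exp_pos _).le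
      _ ≤ 2 ^ Fintype.card ι * Real.exp (B / 2) := sum_exp_sum_mul_bitSign_le b
  have hlog : B / 2 ≤ Real.log (2 ^ Fintype.card ι / #F) := by
    rw [Real.le_log_iff_exp_le (by positivity), le_div_iff₀ hm]
    refine le_of_mul_le_mul_right ?_ (Real.exp_pos (B / 2))
    calc _ = #F * Real.exp B := by rw [mul_right_comm, ← Real.exp_add, add_halves, mul_comm]
      _ ≤ _ := hjensen
  calc ∑ i, (∑ z ∈ F, bitSign (z i)) ^ 2
      = 2 * (#F : ℝ) ^ 2 * (B / 2) := by
        simp only [hb, mul_pow, ← mul_sum, B]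
        ring
    _ ≤ _ := by gcongr

variable [DecidableEq ι]

lemma sum_sum_update {R : Type*} [NonAssocSemiring R] {α : ι → Type*} [∀ i, Fintype (α i)]
    (i : ι) (h : (∀ i, α i) → R) :
    ∑ z, ∑ c, h (Function.update z i c) = Fintype.card (α i) * ∑ z, h z := by
  let swap : (∀ i, α i) × α i → (∀ i, α i) × α i := fun q => (Function.update q.1 i q.2, q.1 i)
  have hswap : Function.Involutive swap := fun q => by simp [swap]
  calc ∑ z, ∑ c, h (Function.update z i c)
      = ∑ q, h (swap q).1 := (Fintype.sum_prod_type fun q => h (swap q).1).symm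
    _ = ∑ q : (∀ i, α i) × α i, h q.1 := hswap.bijective.sum_comp fun q => h q.1
    _ = Fintype.card (α i) * ∑ z, h z := by simp [Fintype.sum_prod_type, mul_sum]

/-- The number of points `z` of the cube such that `g` takes the value `t` after the `i`-th
coordinate of `z` is replaced by `u`. -/
def fibreCount {T : Type*} [DecidableEq T] (g : (ι → Bool) → T) (i : ι) (u : Bool) (t : T) : ℝ :=
  (#{z | g (Function.update z i u) = t} : ℕ)

section FibreCount

variable {T : Type*} [DecidableEq T] (g : (ι → Bool) → T) (i : ι) (t : T)

lemma fibreCount_nonneg (u : Bool) : 0 ≤ fibreCount g i u := fun _ =>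
  Nat.cast_nonneg _

lemma fibreCount_false_add_true :
    fibreCount g i false t + fibreCount g i true t = 2 * (#{z | g z = t} : ℕ) := by
  have h := sum_sum_update i fun z => if g z = t then (1 : ℝ) else 0
  rw [Fintype.card_bool, sum_boole, sum_comm, Fintype.sum_bool, sum_boole, sum_boole] at h
  rw [add_comm, fibreCount, fibreCount]
  exact_mod_cast h

lemma fibreCount_false_sub_true :
    fibreCount g i false t - fibreCount g i true t = 2 * ∑ z with g z = t, bitSign (z i) := by
  have h := sum_sum_update i fun z => if g z = t then bitSign (z i) else 0
  rw [Fintype.card_bool, ← sum_filter, sum_comm, Fintype.sum_bool] at h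
  simp only [Function.update_self, ← sum_filter, sum_const, nsmul_eq_mul, bitSign] at h
  simp only [fibreCount, bitSign]
  norm_num at h ⊢
  linarith

lemma sum_hellingerSq_fibreCount_le [Fintype T] :
    ∑ i, hellingerSq (fibreCount g i false) (fibreCount g i true) ≤
      4 * (2 ^ Fintype.card ι * Real.log (Fintype.card T)) := by
  have hterm : ∀ t, ∑ i, (√(fibreCount g i false t) - √(fibreCount g i true t)) ^ 2 ≤
      4 * ((#{z | g z = t} : ℕ) * Real.log (2 ^ Fintype.card ι / (#{z | g z = t} : ℕ))) := by
    intro t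
    set m : ℝ := ((#{z | g z = t} : ℕ) : ℝ)
    calc ∑ i, (√(fibreCount g i false t) - √(fibreCount g i true t)) ^ 2
        ≤ ∑ i, (2 * ∑ z with g z = t, bitSign (z i)) ^ 2 / (2 * m) := sum_le_sum fun i _ => by
          rw [← fibreCount_false_sub_true, ← fibreCount_false_add_true g i t]
          exact sq_sqrt_sub_sqrt_le (fibreCount_nonneg g i false t) (fibreCount_nonneg g i true t)
      _ = 2 / m * ∑ i, (∑ z with g z = t, bitSign (z i)) ^ 2 := by
          rw [mul_sum]
          refine sum_congr rfl fun i _ => ?_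
          ring
      _ ≤ 2 / m * (2 * m ^ 2 * Real.log (2 ^ Fintype.card ι / m)) := by
          gcongr
          exact sum_sq_sum_bitSign_le _
      _ = 4 * (m * Real.log (2 ^ Fintype.card ι / m)) := by
          rcases eq_or_ne m 0 with hm | hm
          · simp [hm]
          · field_simp; ring
  have hcard : ∑ t, ((#{z | g z = t} : ℕ) : ℝ) = 2 ^ Fintype.card ι := by
    have h := card_eq_sum_card_fiberwise (f := g) (s := univ) (t := univ) (by simp)
    rw [← Nat.cast_sum, ← h, card_univ, Fintype.card_fun, Fintype.card_bool, Nat.cast_pow,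
      Nat.cast_ofNat]
  calc ∑ i, hellingerSq (fibreCount g i false) (fibreCount g i true)
      = ∑ t, ∑ i, (√(fibreCount g i false t) - √(fibreCount g i true t)) ^ 2 := sum_comm
    _ ≤ 4 * ∑ t, _ := (sum_le_sum fun t _ => hterm t).trans_eq (mul_sum ..).symm
    _ ≤ _ := by
      gcongr
      exact sum_mul_log_div_le (fun _ => Nat.cast_nonneg _) hcard

end FibreCount

end Cube

/-! ### Set disjointness -/

lemma card_mul_card_of_complementary {α : Type*} [BooleanAlgebra α] [Fintype α]
    (d : α) (P Q : α → Prop) [DecidablePred P] [DecidablePred Q] :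
    Fintype.card α * #{z | P (d ⊓ z) ∧ Q (dᶜ ⊓ z)} = #{z | P (d ⊓ z)} * #{z | Q (dᶜ ⊓ z)} := by
  classical
  let swap : α × α → α × α := fun q => ((d ⊓ q.1) ⊔ (dᶜ ⊓ q.2), (d ⊓ q.2) ⊔ (dᶜ ⊓ q.1))
  have hd : ∀ x y, d ⊓ ((d ⊓ x) ⊔ (dᶜ ⊓ y)) = d ⊓ x := fun x y => by
    simp [inf_sup_left, ← inf_assoc]
  have hdc : ∀ x y, dᶜ ⊓ ((d ⊓ x) ⊔ (dᶜ ⊓ y)) = dᶜ ⊓ y := fun x y => by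
    simp [inf_sup_left, ← inf_assoc]
  have hswap : Function.Involutive swap := fun q => by
    ext <;> simp only [swap, hd, hdc] <;> rw [inf_comm d, inf_comm dᶜ, sup_inf_inf_compl]
  rw [mul_comm, ← card_univ, ← card_product, ← card_product]
  refine card_bijective swap hswap.bijective fun q => ?_
  simp [swap, hd, hdc]

lemma exists_card_filter_le_of_measure_le {Ω J : Type*} [MeasurableSpace Ω]
    (μ : MeasureTheory.Measure Ω) [MeasureTheory.IsProbabilityMeasure μ] [Fintype J]
    (P : J → Ω → Prop) [∀ j ω, Decidable (P j ω)] {ε : ENNReal} (hP : ∀ j, μ {ω | P j ω} ≤ ε) :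
    ∃ ω, (#{j | P j ω} : ENNReal) ≤ Fintype.card J * ε := by
  let E : J → Set Ω := fun j => MeasureTheory.toMeasurable μ {ω | P j ω}
  have hE : ∀ j, MeasurableSet (E j) := fun j => MeasureTheory.measurableSet_toMeasurable _ _
  obtain ⟨ω, hω⟩ := MeasureTheory.exists_le_lintegral (μ := μ)
    (Finset.measurable_sum univ fun j _ => measurable_one.indicator (hE j)).aemeasurable
    (f := fun ω => ∑ j, (E j).indicator (1 : Ω → ENNReal) ω)
  refine ⟨ω, ?_⟩
  calc (#{j | P j ω} : ENNReal)
      = ∑ j, if P j ω then 1 else 0 := (sum_boole ..).symm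
    _ ≤ ∑ j, (E j).indicator 1 ω := sum_le_sum fun j _ => by
        split_ifs with h
        · have hmem : ω ∈ E j := MeasureTheory.subset_toMeasurable μ {ω | P j ω} h
          simp [hmem]
        · exact bot_le
    _ ≤ ∑ j, ∫⁻ ω, (E j).indicator 1 ω ∂μ :=
        hω.trans_eq (MeasureTheory.lintegral_finsetSum _ fun j _ => measurable_one.indicator (hE j))
    _ ≤ ∑ _j : J, ε := sum_le_sum fun j _ => by
        rw [MeasureTheory.lintegral_indicator_one (hE j), MeasureTheory.measure_toMeasurable]
        exact hP j
    _ = Fintype.card J * ε := by rw [sum_const, card_univ, nsmul_eq_mul]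

/-- `f` is constant on combinatorial rectangles: its level sets are products, as are those of the
transcript of a deterministic two-party protocol. -/
def IsRectangular {X Y T : Type*} (f : X → Y → T) : Prop :=
  ∀ x y x' y', f x y = f x' y' → f x y' = f x y

lemma IsRectangular.eq_iff {X Y T : Type*} {f : X → Y → T} (hf : IsRectangular f) {x : X} {y : Y}
    {t : T} : f x y = t ↔ (∃ y', f x y' = t) ∧ ∃ x', f x' y = t :=
  ⟨fun h => ⟨⟨y, h⟩, ⟨x, h⟩⟩, fun ⟨⟨y', hy'⟩, ⟨x', hx'⟩⟩ =>
    (hf x y' x' y (hy'.trans hx'.symm)).trans hy'⟩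

section Disjointness

variable {ι : Type*} [DecidableEq ι]

/-- The input of a party that holds the coordinates marked by `d`: the bits of `z` at these
coordinates, zero elsewhere, with the bit `b` planted at `i`. The other party's input is
`plant dᶜ z i b`, so that the two can only meet at `i`. -/
def plant (d z : ι → Bool) (i : ι) (b : Bool) : ι → Bool :=
  Function.update (d ⊓ z) i b

lemma disjoint_plant_compl (d z : ι → Bool) (i : ι) (b : Bool) :
    Disjoint (plant d z i b) (plant dᶜ z i b) ↔ b = false := by
  have hmeet : plant d z i b ⊓ plant dᶜ z i b = Function.update ⊥ i b := by
    funext j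
    by_cases hj : j = i
    · subst hj; simp [plant]
    · cases hd : d j <;> simp [plant, hj, hd]
  rw [disjoint_iff, hmeet, Function.update_eq_self_iff]
  rfl

variable [Fintype ι] {T : Type*}

section PlantedCount

variable [DecidableEq T]

/-- The number of points `z` of the cube such that `f` takes the value `t` on the two inputs that
`d` and `z` determine when the bits `u` and `v` are planted at `i`. -/
def plantedCount (f : (ι → Bool) → (ι → Bool) → T) (d : ι → Bool) (i : ι) (u v : Bool) (t : T) :
    ℝ :=
  (#{z | f (plant d z i u) (plant dᶜ z i v) = t} : ℕ)

variable {f : (ι → Bool) → (ι → Bool) → T} (d : ι → Bool) (i : ι)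

lemma plantedCount_nonneg (u v : Bool) : 0 ≤ plantedCount f d i u v := fun _ =>
  Nat.cast_nonneg _

lemma sum_plantedCount [Fintype T] (u v : Bool) :
    ∑ t, plantedCount f d i u v t = 2 ^ Fintype.card ι := by
  have h := card_eq_sum_card_fiberwise (f := fun z => f (plant d z i u) (plant dᶜ z i v))
    (s := univ) (t := univ) (by simp)
  simp only [plantedCount]
  rw [← Nat.cast_sum, ← h, card_univ, Fintype.card_fun, Fintype.card_bool, Nat.cast_pow,
    Nat.cast_ofNat]

lemma plantedCount_update (u v c : Bool) :
    plantedCount f (Function.update d i c) i u v = plantedCount f d i u v := by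
  have hplant : ∀ {d d' : ι → Bool}, (∀ j ≠ i, d j = d' j) → ∀ z b,
      plant d z i b = plant d' z i b := fun h z b => by
    funext j
    by_cases hj : j = i
    · subst hj; simp [plant]
    · simp [plant, hj, h j hj]
  unfold plantedCount
  simp only [hplant (d := Function.update d i c) (d' := d) fun j hj => by simp [hj],
    hplant (d := (Function.update d i c)ᶜ) (d' := dᶜ) fun j hj => by simp [hj]]

lemma plantedCount_flip (u v : Bool) :
    plantedCount (flip f) dᶜ i v u = plantedCount f d i u v := by
  unfold plantedCount
  simp only [compl_compl, flip]

lemma plantedCount_false_right {d : ι → Bool} (hd : d i = true) (u : Bool) :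
    plantedCount f d i u false = fibreCount (fun z => f (d ⊓ z) (dᶜ ⊓ z)) i u := by
  have hA : ∀ z, plant d z i u = d ⊓ Function.update z i u := fun z => by
    funext j
    by_cases hj : j = i
    · subst hj; simp [plant, hd]
    · simp [plant, hj]
  have hB : ∀ z, plant dᶜ z i false = dᶜ ⊓ Function.update z i u := fun z => by
    funext j
    by_cases hj : j = i
    · subst hj; simp [plant, hd]
    · simp [plant, hj]
  unfold plantedCount fibreCount
  simp only [hA, hB]

lemma plantedCount_false_left {d : ι → Bool} (hd : d i = false) (v : Bool) :
    plantedCount f d i false v = fibreCount (fun z => f (d ⊓ z) (dᶜ ⊓ z)) i v := by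
  rw [← plantedCount_flip, plantedCount_false_right i (by simp [hd]), compl_compl]
  rfl

lemma plantedCount_mul_plantedCount (hf : IsRectangular f) :
    plantedCount f d i true false * plantedCount f d i false true =
      plantedCount f d i false false * plantedCount f d i true true := by
  classical
  funext t
  let P : Bool → (ι → Bool) → Prop := fun u x => ∃ y, f (Function.update x i u) y = t
  let Q : Bool → (ι → Bool) → Prop := fun v y => ∃ x, f x (Function.update y i v) = t
  have hmul : ∀ u v, 2 ^ Fintype.card ι * plantedCount f d i u v t =
      (#{z | P u (d ⊓ z)} : ℕ) * (#{z | Q v (dᶜ ⊓ z)} : ℕ) := fun u v => by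
    have h := card_mul_card_of_complementary d (P u) (Q v)
    rw [Fintype.card_fun, Fintype.card_bool] at h
    rw [plantedCount, filter_congr fun z _ => hf.eq_iff]
    exact_mod_cast h
  have hN : (2 ^ Fintype.card ι * 2 ^ Fintype.card ι : ℝ) ≠ 0 := by positivity
  refine mul_left_cancel₀ hN ?_
  rw [Pi.mul_apply, Pi.mul_apply, mul_mul_mul_comm, hmul, hmul,
    mul_mul_mul_comm _ _ (plantedCount ..), hmul, hmul]
  ring

end PlantedCount

section Errors

variable [Fintype T] (f : (ι → Bool) → (ι → Bool) → T)

/-- How much the value of `f` reveals on the `i`-th bit of `z` when `d` distributes the bits of `z`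
among the two parties, as a squared Hellinger distance. -/
noncomputable def bitLeak [DecidableEq T] (i : ι) (d : ι → Bool) : ℝ :=
  hellingerSq (fibreCount (fun z => f (d ⊓ z) (dᶜ ⊓ z)) i false)
    (fibreCount (fun z => f (d ⊓ z) (dᶜ ⊓ z)) i true)

lemma sum_hellingerSq_plantedCount_le [DecidableEq T] (hf : IsRectangular f) (i : ι) :
    ∑ d, hellingerSq (plantedCount f d i false false) (plantedCount f d i true true) ≤
      4 * ∑ d, bitLeak f i d := by
  have hA : ∀ d, hellingerSq (plantedCount f d i false false) (plantedCount f d i true false) =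
      bitLeak f i (Function.update d i true) := fun d => by
    rw [← plantedCount_update d i _ _ true, ← plantedCount_update d i true _ true,
      plantedCount_false_right i (by simp), plantedCount_false_right i (by simp), bitLeak]
  have hB : ∀ d, hellingerSq (plantedCount f d i false false) (plantedCount f d i false true) =
      bitLeak f i (Function.update d i false) := fun d => by
    rw [← plantedCount_update d i _ _ false, ← plantedCount_update d i _ true false,
      plantedCount_false_left i (by simp), plantedCount_false_left i (by simp), bitLeak]
  calc ∑ d, hellingerSq (plantedCount f d i false false) (plantedCount f d i true true)
      ≤ ∑ d, 2 * ∑ c, bitLeak f i (Function.update d i c) := sum_le_sum fun d _ => by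
        rw [Fintype.sum_bool, ← hA, ← hB]
        exact hellingerSq_le_of_mul_eq_mul (plantedCount_nonneg d i _ _)
          (plantedCount_nonneg d i _ _) (plantedCount_nonneg d i _ _)
          (plantedCount_nonneg d i _ _) (plantedCount_mul_plantedCount d i hf)
          (by simp only [sum_plantedCount])
    _ = 4 * ∑ d, bitLeak f i d := by
        rw [← mul_sum, sum_sum_update, Fintype.card_bool]
        ring

/-- The number of points `z` of the cube for which `out` fails to decide disjointness of the
two inputs with the bit `b` planted at `i`. By `disjoint_plant_compl` the right answer is `!b`. -/
def plantedErrors (out : T → Bool) (d : ι → Bool) (i : ι) (b : Bool) : ℕ :=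
  #{z | out (f (plant d z i b) (plant dᶜ z i b)) = b}

lemma natCast_plantedErrors [DecidableEq T] (out : T → Bool) (d : ι → Bool) (i : ι) (b : Bool) :
    (plantedErrors f out d i b : ℝ) = ∑ t with out t = b, plantedCount f d i b b t := by
  simp only [plantedErrors, plantedCount]
  rw [← Nat.cast_sum, sum_filter, card_eq_sum_card_fiberwise (t := univ)
    (f := fun z => f (plant d z i b) (plant dᶜ z i b)) (by simp)]
  refine congrArg Nat.cast (sum_congr rfl fun t _ => ?_)
  rw [filter_filter]
  split_ifs with ht
  · exact congrArg card (filter_congr fun z _ => ⟨And.right, fun h => ⟨h ▸ ht, h⟩⟩)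
  · exact card_eq_zero.2 (filter_eq_empty_iff.2 fun z _ h => ht (h.2 ▸ h.1))

lemma sub_hellingerSq_le_sum_plantedErrors [DecidableEq T] (out : T → Bool) (d : ι → Bool) (i : ι) :
    5 / 6 * 2 ^ Fintype.card ι -
        3 / 2 * hellingerSq (plantedCount f d i false false) (plantedCount f d i true true) ≤
      ∑ b, (plantedErrors f out d i b : ℝ) := by
  have hmin := sub_hellingerSq_le_sum_min (plantedCount_nonneg (f := f) d i false false)
    (plantedCount_nonneg (f := f) d i true true)
  rw [sum_plantedCount, sum_plantedCount] at hmin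
  calc _ ≤ ∑ t, min (plantedCount f d i false false t) (plantedCount f d i true true t) := by
        linarith
    _ = ∑ b, ∑ t with out t = b,
          min (plantedCount f d i false false t) (plantedCount f d i true true t) :=
        (sum_fiberwise ..).symm
    _ ≤ ∑ b, (plantedErrors f out d i b : ℝ) := sum_le_sum fun b _ => by
        rw [natCast_plantedErrors]
        refine sum_le_sum fun t _ => ?_
        cases b
        exacts [min_le_left _ _, min_le_right _ _]

lemma card_le_log_card_of_plantedErrors_le (hf : IsRectangular f) (out : T → Bool)
    (herr : 3 * ∑ i, ∑ d, ∑ b, (plantedErrors f out d i b : ℝ) ≤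
      2 * Fintype.card ι * (2 ^ Fintype.card ι * 2 ^ Fintype.card ι)) :
    (Fintype.card ι : ℝ) ≤ 144 * Real.log (Fintype.card T) := by
  classical
  set N : ℝ := 2 ^ Fintype.card ι with hN
  have hcard : (#(univ : Finset (ι → Bool)) : ℝ) = N := by simp [hN]
  have hlower : ∀ i, 5 / 6 * (N * N) - 6 * ∑ d, bitLeak f i d ≤
      ∑ d, ∑ b, (plantedErrors f out d i b : ℝ) := fun i => by
    have h := sum_le_sum fun d (_ : d ∈ univ) => sub_hellingerSq_le_sum_plantedErrors f out d i
    rw [sum_sub_distrib, sum_const, nsmul_eq_mul, hcard, ← hN, ← mul_sum] at h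
    linarith [sum_hellingerSq_plantedCount_le f hf i]
  have hupper : ∑ i, ∑ d, bitLeak f i d ≤ N * (4 * (N * Real.log (Fintype.card T))) := by
    rw [sum_comm, ← hcard, ← nsmul_eq_mul]
    exact sum_le_card_nsmul _ _ _ fun d _ => by
      rw [hcard]
      exact sum_hellingerSq_fibreCount_le _
  have hsum := sum_le_sum fun i (_ : i ∈ univ) => hlower i
  rw [sum_sub_distrib, sum_const, card_univ, nsmul_eq_mul, ← mul_sum] at hsum
  refine le_of_mul_le_mul_left (a := N * N) ?_ (by positivity)
  linarith

end Errors

end Disjointness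

theorem card_le_log_card_of_disjoint {ι T : Type*} [Fintype ι] [Fintype T] {Ω : Type*}
    [MeasurableSpace Ω] (μ : MeasureTheory.Measure Ω) [MeasureTheory.IsProbabilityMeasure μ]
    {f : Ω → (ι → Bool) → (ι → Bool) → T} (hf : ∀ ω, IsRectangular (f ω)) (out : Ω → T → Bool)
    (herr : ∀ x y, μ {ω | ¬ (out ω (f ω x y) = true ↔ Disjoint x y)} ≤ 1 / 3) :
    (Fintype.card ι : ℝ) ≤ 144 * Real.log (Fintype.card T) := by
  classical
  obtain ⟨ω, hω⟩ := exists_card_filter_le_of_measure_le μ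
    (fun (j : ι × (ι → Bool) × Bool × (ι → Bool)) ω =>
      out ω (f ω (plant j.2.1 j.2.2.2 j.1 j.2.2.1) (plant j.2.1ᶜ j.2.2.2 j.1 j.2.2.1)) = j.2.2.1)
    (fun ⟨i, d, b, z⟩ => by
      convert herr (plant d z i b) (plant dᶜ z i b) using 4
      rw [disjoint_plant_compl]
      cases b <;> simp)
  refine card_le_log_card_of_plantedErrors_le (f ω) (hf ω) (out ω) ?_
  have hcount : #{j : ι × (ι → Bool) × Bool × (ι → Bool) |
      out ω (f ω (plant j.2.1 j.2.2.2 j.1 j.2.2.1) (plant j.2.1ᶜ j.2.2.2 j.1 j.2.2.1)) =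
        j.2.2.1} = ∑ i, ∑ d, ∑ b, plantedErrors (f ω) (out ω) d i b := by
    simp only [plantedErrors, card_filter, Fintype.sum_prod_type]
  rw [hcount, one_div, ← div_eq_mul_inv, ENNReal.le_div_iff_mul_le (by simp) (by simp)] at hω
  have herrors : (∑ i, ∑ d, ∑ b, plantedErrors (f ω) (out ω) d i b) * 3 ≤
      Fintype.card (ι × (ι → Bool) × Bool × (ι → Bool)) := by
    exact_mod_cast hω
  simp only [Fintype.card_prod, Fintype.card_fun, Fintype.card_bool] at herrors
  have herrors_real := Nat.cast_le (α := ℝ).2 herrors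
  push_cast at herrors_real
  linarith

/-! ### Reduction from set disjointness -/

namespace StreamAlg

variable {τ β : Type*} {s : ℕ} (A : StreamAlg τ β s)

lemma readFrom_append (k i : ℕ) (l l' : List τ) (m : Fin (2 ^ s)) :
    A.readFrom k i (l ++ l') m = A.readFrom k (i + l.length) l' (A.readFrom k i l m) := by
  induction l generalizing i m with
  | nil => rfl
  | cons e l ih =>
    simp only [List.cons_append, readFrom, List.length_cons, ih]
    congr 1
    omega

/-- The messages that two players holding `l` and `l'` exchange to run `A` for `p` passes over
`l ++ l'`: in each pass, the memory after the first and after the second part of the stream. -/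
def transcript (p : ℕ) (l l' : List τ) : Fin p → Fin (2 ^ s) × Fin (2 ^ s) := fun k =>
  (A.readFrom k 0 l (A.memAfter (l ++ l') k), A.memAfter (l ++ l') (k + 1))

lemma isRectangular_transcript {X Y : Type*} (p : ℕ) {lA : X → List τ} (lB : Y → List τ)
    (hlen : ∀ x x', (lA x).length = (lA x').length) :
    IsRectangular fun x y => A.transcript p (lA x) (lB y) := by
  intro x y x' y' h
  let mid : X → Y → ℕ → Fin (2 ^ s) := fun x y k =>
    A.readFrom k 0 (lA x) (A.memAfter (lA x ++ lB y) k)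
  have hsucc : ∀ x y k, A.memAfter (lA x ++ lB y) (k + 1) =
      A.readFrom k (lA x).length (lB y) (mid x y k) := fun x y k => by
    rw [memAfter, readFrom_append, Nat.zero_add]
  have hmid_of_mem : ∀ k, A.memAfter (lA x ++ lB y') k = A.memAfter (lA x ++ lB y) k →
      mid x y' k = mid x y k := fun k hk => by
    simp only [mid, hk]
  have hmem : ∀ k ≤ p, A.memAfter (lA x ++ lB y') k = A.memAfter (lA x ++ lB y) k := fun k => by
    induction k with
    | zero => exact fun _ => rfl
    | succ k ih =>
      intro hk
      obtain ⟨hmid, hend⟩ := Prod.mk.inj (congrFun h ⟨k, hk⟩)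
      calc A.memAfter (lA x ++ lB y') (k + 1)
          = A.readFrom k (lA x').length (lB y') (mid x' y' k) := by
            rw [hsucc, hmid_of_mem k (ih (Nat.le_of_succ_le hk)), hlen x x']
            exact congrArg _ hmid
        _ = A.memAfter (lA x ++ lB y) (k + 1) := (hsucc x' y' k).symm.trans hend.symm
  funext k
  exact Prod.ext (hmid_of_mem k (hmem k k.2.le)) (hmem (k + 1) k.2)

end StreamAlg

section Reversal

variable {V : Type*}

open Classical in
/-- The edge of `reversal r` between the ends of the increasing pair `e`. -/
noncomputable def orient (r : Set (V × V)) (e : V × V) : V × V := if e ∈ r then e.swap else e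

lemma orient_congr {r r' : Set (V × V)} {e : V × V} (h : e ∈ r ↔ e ∈ r') :
    orient r e = orient r' e := by
  classical exact if_congr h rfl rfl

variable [LinearOrder V] (r : Set (V × V))

/-- The transitive tournament on a linear order, with the edges in `r` reversed. -/
def reversal : Digraph V where
  Adj u v := u < v ∧ (u, v) ∉ r ∨ v < u ∧ (v, u) ∈ r

lemma isTournament_reversal : IsTournament (reversal r) := by
  refine ⟨fun v hv => hv.elim (fun h => h.1.false) (fun h => h.1.false), fun v w hne => ?_⟩
  simp only [Xor, reversal]
  rcases lt_or_gt_of_ne hne with h | h <;> have := h.asymm <;> tauto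

lemma injOn_orient : Set.InjOn (orient r) {e | e.1 < e.2} := fun e he e' he' h => by
  unfold orient at h
  split_ifs at h
  · exact Prod.swap_injective h
  · exact absurd he (h ▸ he').asymm
  · exact absurd he' (h ▸ he).asymm
  · exact h

lemma exists_orient_eq_iff {e : V × V} :
    (∃ e' : V × V, e'.1 < e'.2 ∧ orient r e' = e) ↔ (reversal r).Adj e.1 e.2 := by
  constructor
  · rintro ⟨⟨a, b⟩, hab, rfl⟩
    by_cases hr : (a, b) ∈ r
    · exact Or.inr (by simpa [orient, hr] using hab)
    · exact Or.inl (by simpa [orient, hr] using hab)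
  · rintro (⟨hlt, hr⟩ | ⟨hlt, hr⟩)
    · exact ⟨e, hlt, if_neg hr⟩
    · exact ⟨e.swap, hlt, if_pos hr⟩

end Reversal

lemma IsStreamOf.map_orient {n : ℕ} {l : List (Fin n × Fin n)} (hl : IsStreamOf ⟨(· < ·)⟩ l)
    (r : Set (Fin n × Fin n)) : IsStreamOf (reversal r) (l.map (orient r)) := by
  refine ⟨hl.1.map_on fun e he e' he' => injOn_orient r ((hl.2 e).1 he) ((hl.2 e').1 he'),
    fun e => ?_⟩
  simp only [List.mem_map, hl.2, exists_orient_eq_iff]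

lemma IsStreamOf.perm {n : ℕ} {G : Digraph (Fin n)} {l l' : List (Fin n × Fin n)}
    (hl : IsStreamOf G l) (h : l.Perm l') : IsStreamOf G l' :=
  ⟨h.nodup_iff.1 hl.1, fun e => h.mem_iff.symm.trans (hl.2 e)⟩

lemma exists_isStreamOf {n : ℕ} (G : Digraph (Fin n)) : ∃ l, IsStreamOf G l := by
  classical
  exact ⟨({e | G.Adj e.1 e.2} : Finset (Fin n × Fin n)).toList, nodup_toList _, by simp⟩

section Triangles

variable {n k : ℕ}

/-- The pairs `(3 * i + j, 3 * i + j + 1)` with `x i = true`. -/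
def markedPairs (n j : ℕ) (x : Fin k → Bool) : Set (Fin n × Fin n) :=
  {e | ∃ i, x i = true ∧ e.1.val = 3 * i + j ∧ e.2.val = 3 * i + j + 1}

/-- The tournament in which the vertices `3 * i`, `3 * i + 1`, `3 * i + 2` form a directed cycle if
and only if `x i` and `y i` both hold, all other pairs being directed increasingly. -/
def triangles (n : ℕ) (x y : Fin k → Bool) : Digraph (Fin n) :=
  reversal (markedPairs n 0 x ∪ markedPairs n 1 y)

lemma disjoint_of_isAcyclic_triangles (hk : 3 * k ≤ n) {x y : Fin k → Bool}
    (h : IsAcyclic (triangles n x y)) : Disjoint x y := by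
  rw [Pi.disjoint_iff]
  intro i
  by_contra hxy
  obtain ⟨hx, hy⟩ : x i = true ∧ y i = true := by
    rw [disjoint_iff] at hxy
    exact Bool.and_eq_true_iff.1 (Bool.eq_true_of_not_eq_false hxy)
  have hi := i.2
  let a : Fin n := ⟨3 * i, by omega⟩
  let b : Fin n := ⟨3 * i + 1, by omega⟩
  let c : Fin n := ⟨3 * i + 2, by omega⟩
  have hac : (triangles n x y).Adj a c := by
    refine Or.inl ⟨by simp [a, c], ?_⟩
    rintro (⟨j, -, h1, h2⟩ | ⟨j, -, h1, h2⟩) <;> simp only [a, c] at h1 h2 <;> omega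
  have hcb : (triangles n x y).Adj c b :=
    Or.inr ⟨by simp [b, c], Or.inr ⟨i, hy, rfl, rfl⟩⟩
  have hba : (triangles n x y).Adj b a :=
    Or.inr ⟨by simp [a, b], Or.inl ⟨i, hx, rfl, rfl⟩⟩
  exact h a (.tail (.tail (.single hac) hcb) hba)

lemma isAcyclic_triangles_of_disjoint {x y : Fin k → Bool} (hxy : Disjoint x y) :
    IsAcyclic (triangles n x y) := by
  classical
  let a : Fin n → ℤ := fun v => if ∃ i, x i = true ∧ v.val = 3 * i then 4 else 0
  let b : Fin n → ℤ := fun v => if ∃ i, y i = true ∧ v.val = 3 * i + 2 then 4 else 0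
  have ha : ∀ v, 0 ≤ a v := fun v => ite_nonneg (by norm_num) le_rfl
  have hb : ∀ v, 0 ≤ b v := fun v => ite_nonneg (by norm_num) le_rfl
  have ha_zero : ∀ v, v.val % 3 ≠ 0 → a v = 0 := fun v hv => if_neg fun ⟨i, _, hi⟩ => by omega
  have hb_zero : ∀ v, v.val % 3 ≠ 2 → b v = 0 := fun v hv => if_neg fun ⟨i, _, hi⟩ => by omega
  have hdisj : ∀ i, x i = true → y i = true → False := fun i hx hy => by
    simpa [hx, hy] using Pi.disjoint_iff.1 hxy i
  -- Reversing `(3 * i, 3 * i + 1)` moves `3 * i` up past `3 * i + 1`, and reversing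
  -- `(3 * i + 1, 3 * i + 2)` moves `3 * i + 2` down; a single such move leaves the two outer
  -- vertices in order.
  refine isAcyclic_of_adj_lt (r := fun v => 3 * (v : ℤ) + a v - b v) fun u v huv => ?_
  rcases huv with ⟨hlt, hrev⟩ | ⟨-, ⟨i, hx, hv, hu⟩ | ⟨i, hy, hv, hu⟩⟩
  · rw [Fin.lt_def] at hlt
    have hgap : a u + b v < 3 * (v - u : ℤ) := by
      simp only [a, b]
      split_ifs with hau hbv hbv
      · obtain ⟨⟨i, hx, hi⟩, j, hy, hj⟩ := And.intro hau hbv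
        have hij : i.val ≠ j := fun h => hdisj j (Fin.ext h ▸ hx) hy
        omega
      · obtain ⟨i, hx, hi⟩ := hau
        have hv : v.val ≠ 3 * i + 1 := fun h => hrev (Or.inl ⟨i, hx, hi, h⟩)
        omega
      · obtain ⟨i, hy, hi⟩ := hbv
        have hu : u.val ≠ 3 * i + 1 := fun h => hrev (Or.inr ⟨i, hy, h, hi⟩)
        omega
      · omega
    linarith [hb u, ha v]
  · dsimp only at hv hu
    have hav : a v = 4 := if_pos ⟨i, hx, hv⟩
    linarith [hb u, ha_zero u (by omega), hb_zero v (by omega), (by omega : (u : ℤ) = v + 1)]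
  · dsimp only at hv hu
    have hbu : b u = 4 := if_pos ⟨i, hy, hu⟩
    linarith [ha v, ha_zero u (by omega), hb_zero v (by omega), (by omega : (u : ℤ) = v + 1)]

lemma isAcyclic_triangles_iff (hk : 3 * k ≤ n) {x y : Fin k → Bool} :
    IsAcyclic (triangles n x y) ↔ Disjoint x y :=
  ⟨disjoint_of_isAcyclic_triangles hk, isAcyclic_triangles_of_disjoint⟩

lemma IsStreamOf.triangles {l : List (Fin n × Fin n)} (hl : IsStreamOf ⟨(· < ·)⟩ l)
    (x y : Fin k → Bool) : IsStreamOf (triangles n x y)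
      ((l.filter (·.1.val % 3 = 0)).map (orient (markedPairs n 0 x)) ++
        (l.filter (·.1.val % 3 ≠ 0)).map (orient (markedPairs n 1 y))) := by
  have hAlice : ∀ e : Fin n × Fin n, e.1.val % 3 = 0 →
      orient (markedPairs n 0 x) e = orient (markedPairs n 0 x ∪ markedPairs n 1 y) e :=
    fun e he => by
      have hy : e ∉ markedPairs n 1 y := fun ⟨i, _, hi, _⟩ => by omega
      exact orient_congr ⟨Or.inl, fun h => h.resolve_right hy⟩
  have hBob : ∀ e : Fin n × Fin n, e.1.val % 3 ≠ 0 →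
      orient (markedPairs n 1 y) e = orient (markedPairs n 0 x ∪ markedPairs n 1 y) e :=
    fun e he => by
      have hx : e ∉ markedPairs n 0 x := fun ⟨i, _, hi, _⟩ => by omega
      exact orient_congr ⟨Or.inr, fun h => h.resolve_left hx⟩
  rw [List.map_congr_left fun e he => hAlice e (by simpa using (List.mem_filter.1 he).2),
    List.map_congr_left fun e he => hBob e (by simpa using (List.mem_filter.1 he).2),
    ← List.map_append]
  refine (hl.map_orient _).perm (List.Perm.map _ ?_)
  simpa only [decide_not] using (List.filter_append_perm _ l).symm

end Triangles

theorem card_le_of_randSolves {n k : ℕ} (hk : 3 * k ≤ n) {β : Type*}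
    {Q : Digraph (Fin n) → β → Prop} {dec : β → Bool}
    (hQ : ∀ G b, IsTournament G → Q G b → acyc G (dec b)) {p : ℕ} (hp : 1 ≤ p) {s : ℕ}
    {Ω : Type*} [MeasurableSpace Ω] {μ : MeasureTheory.Measure Ω}
    [MeasureTheory.IsProbabilityMeasure μ] {A : Ω → StreamAlg (Fin n × Fin n) β s}
    (hA : RandSolves Q p μ A) : (k : ℝ) ≤ 288 * (s * p) := by
  obtain ⟨l, hl⟩ := exists_isStreamOf (⟨(· < ·)⟩ : Digraph (Fin n))
  obtain ⟨q, rfl⟩ := Nat.exists_eq_add_of_le' hp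
  have hlog := card_le_log_card_of_disjoint (ι := Fin k) μ
    (fun ω => (A ω).isRectangular_transcript (q + 1)
      (fun y => (l.filter (·.1.val % 3 ≠ 0)).map (orient (markedPairs n 1 y)))
      (lA := fun x => (l.filter (·.1.val % 3 = 0)).map (orient (markedPairs n 0 x)))
      (fun x x' => by simp only [List.length_map]))
    (fun ω t => dec ((A ω).output (t (Fin.last q)).2))
    (fun x y => by
      refine le_trans (MeasureTheory.measure_mono ?_)
        (hA _ (isTournament_reversal _) _ (hl.triangles x y))
      exact fun ω hω hcorrect => hω <|
        (hQ _ _ (isTournament_reversal _) hcorrect).trans (isAcyclic_triangles_iff hk))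
  have hcard : Real.log (Fintype.card (Fin (q + 1) → Fin (2 ^ s) × Fin (2 ^ s))) =
      2 * (s * (q + 1 : ℕ)) * Real.log 2 := by
    simp only [Fintype.card_fun, Fintype.card_prod, Fintype.card_fin, ← pow_add, ← pow_mul]
    push_cast
    rw [Real.log_pow]
    push_cast
    ring
  rw [hcard, Fintype.card_fin] at hlog
  have hlog_two : Real.log 2 ≤ 1 := by linarith [Real.log_two_lt_d9]
  have hbits := mul_le_mul_of_nonneg_left hlog_two
    (by positivity : (0 : ℝ) ≤ 2 * (s * (q + 1 : ℕ)))
  linarith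

theorem mul_div_le_of_randSolves {n : ℕ} {β : Type*} {Q : Digraph (Fin n) → β → Prop}
    {dec : β → Bool} (hQ : ∀ G b, IsTournament G → Q G b → acyc G (dec b)) (hn : 3 ≤ n) {p : ℕ}
    (hp : 1 ≤ p) {s : ℕ} {Ω : Type*} [MeasurableSpace Ω] {μ : MeasureTheory.Measure Ω}
    [MeasureTheory.IsProbabilityMeasure μ] {A : Ω → StreamAlg (Fin n × Fin n) β s}
    (hA : RandSolves Q p μ A) : (1 / 1440 : ℝ) * (n / p) ≤ s := by
  have hk := card_le_of_randSolves (Nat.mul_div_le n 3) hQ hp hA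
  have hn5 : (n : ℝ) ≤ 5 * (n / 3 : ℕ) := by exact_mod_cast (by omega : n ≤ 5 * (n / 3))
  rw [← mul_div_assoc, div_le_iff₀ (by exact_mod_cast hp)]
  linarith

end TournamentStream

/-- Acyclicity of tournaments in the data stream model. Upper bound: one pass and `O(n log n)` bits
suffice, deterministically, in the model used for the lower bounds and also for one fixed program of
a random access machine. Lower bounds: `p` passes need `Ω(n / p)` bits, even for randomized
algorithms with error probability `1/3`, and the same holds for `α`-approximating the
size of a minimum feedback arc set, with a constant that does not depend on `α`. -/
theorem mainTheorem9 :
    (∃ C : ℝ, ∀ n : ℕ, 2 ≤ n → ∃ s : ℕ, (s : ℝ) ≤ C * (n * Real.log n) ∧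
      ∃ A : TournamentStream.StreamAlg (Fin n × Fin n) Bool s,
        TournamentStream.Solves TournamentStream.acyc 1 A) ∧
    (∃ (P : List TournamentStream.Instr) (C : ℝ), ∀ n : ℕ, 2 ≤ n →
      ∃ m w : ℕ, ((m * w : ℕ) : ℝ) ≤ C * (n * Real.log n) ∧
        ∀ G : Digraph (Fin n), TournamentStream.IsTournament G →
          ∀ l, TournamentStream.IsStreamOf G l →
            (∃ b, TournamentStream.Answers P l b ∧ TournamentStream.acyc G b) ∧
            TournamentStream.WorksIn P l m w) ∧
    (∃ c : ℝ, 0 < c ∧ ∃ n₀ : ℕ, ∀ n : ℕ, n₀ ≤ n → ∀ p : ℕ, 1 ≤ p → ∀ s : ℕ,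
      ∀ (Ω : Type u) [MeasurableSpace Ω] (μ : MeasureTheory.Measure Ω)
        [MeasureTheory.IsProbabilityMeasure μ]
        (A : Ω → TournamentStream.StreamAlg (Fin n × Fin n) Bool s),
        TournamentStream.RandSolves TournamentStream.acyc p μ A → c * (n / p) ≤ (s : ℝ)) ∧
    (∃ c : ℝ, 0 < c ∧ ∃ n₀ : ℕ, ∀ n : ℕ, n₀ ≤ n → ∀ p : ℕ, 1 ≤ p → ∀ α : ℝ, 1 ≤ α → ∀ s : ℕ,
      ∀ (Ω : Type u) [MeasurableSpace Ω] (μ : MeasureTheory.Measure Ω)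
        [MeasureTheory.IsProbabilityMeasure μ]
        (A : Ω → TournamentStream.StreamAlg (Fin n × Fin n) ℤ s),
        TournamentStream.RandSolves (TournamentStream.fasSizeApprox α) p μ A →
          c * (n / p) ≤ (s : ℝ)) := by
  refine ⟨TournamentStream.exists_solves_acyc, TournamentStream.exists_program_acyc,
    ⟨1 / 1440, by norm_num, 3, ?_⟩, ⟨1 / 1440, by norm_num, 3, ?_⟩⟩
  · intro n hn p hp s Ω _ μ _ A hA
    exact TournamentStream.mul_div_le_of_randSolves (dec := id) (fun _ _ _ h => h) hn hp hA
  · intro n hn p hp α _ s Ω _ μ _ A hA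
    exact TournamentStream.mul_div_le_of_randSolves (dec := fun b => decide (b = 0))
      (fun _ _ hG h => h.acyc hG) hn hp hA
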